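/- Let $P\subset\mathbb H^n$ be a hyperbolic Coxeter $n$-polytope of finite volume, that is, an intersection of finitely many closed half-spaces of $\mathbb H^n$ with non-empty interior and finite volume, such that the dihedral angle between any two facets meeting in a face of dimension $n-2$ is $\pi/m$ for some integer $m\ge 2$. Ideal vertices are counted as vertices, so the combinatorial type of $P$ is that of the closure $\overline P$ of $P$ in $\mathbb H^n\cup\partial\mathbb H^n$. 1. If $P$ has exactly $n+2$ facets, then $P$ is combinatorially equivalent (isomorphic face lattice) either to a product $\Delta^k\times\Delta^l$ of two simplices with $k,l\ge 1$, $k+l=n$, or to a pyramid over a product $\Delta^k\times\Delta^l$ of two simplices with $k,l\ge 1$, $k+l=n-1$. 2. With any number of facets, $\overline P$ is not a multipyramid. Here a pyramid is the convex hull of a polytope that is not a simplex (the base) and a point, possibly ideal, outside the affine hull of the base (the apex); a multipyramid is a pyramid whose base is itself a pyramid. -/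

import Mathlib

/-! ### Combinatorial types of convex polytopes -/

/-- Combinatorial equivalence: the posets of (exposed) faces, ordered by inclusion and including
the empty face and the whole polytope, are isomorphic. For polytopes every face is exposed. -/
def CombEquiv {V W : Type*} [AddCommGroup V] [Module ℝ V] [TopologicalSpace V]
    [AddCommGroup W] [Module ℝ W] [TopologicalSpace W] (A : Set V) (B : Set W) : Prop :=
  Nonempty ({F : Set V // IsExposed ℝ A F} ≃o {G : Set W // IsExposed ℝ B G})

/-- The product of a `k`-simplex and an `l`-simplex. -/
def simplexProduct (k l : ℕ) : Set ((Fin (k + 1) → ℝ) × (Fin (l + 1) → ℝ)) :=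
  stdSimplex ℝ (Fin (k + 1)) ×ˢ stdSimplex ℝ (Fin (l + 1))

/-- The standard pyramid over `B`: the convex hull of `B`, placed at height `0`, and an apex at
height `1`. -/
def pyramidOver {V : Type*} [AddCommGroup V] [Module ℝ V] (B : Set V) : Set (V × ℝ) :=
  convexHull ℝ (insert ((0 : V), (1 : ℝ)) (B ×ˢ {(0 : ℝ)}))

/-- `B` is a simplex: the convex hull of finitely many affinely independent points. -/
def IsSimplex {V : Type*} [AddCommGroup V] [Module ℝ V] (B : Set V) : Prop :=
  ∃ s : Finset V, AffineIndependent ℝ (fun v : s => (v : V)) ∧ B = convexHull ℝ (s : Set V)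

/-- `Q` is a pyramid with base `B`: the base is a convex polytope which is not a simplex, and `Q`
is the convex hull of the base and a point (the apex) outside its affine hull. -/
def IsPyramidWithBase {V : Type*} [AddCommGroup V] [Module ℝ V] (Q B : Set V) : Prop :=
  (∃ s : Finset V, B = convexHull ℝ (s : Set V)) ∧ ¬ IsSimplex B ∧
    ∃ a : V, a ∉ affineSpan ℝ B ∧ Q = convexHull ℝ (insert a B)

/-- A multipyramid is a pyramid over a pyramid. -/
def IsMultipyramid {V : Type*} [AddCommGroup V] [Module ℝ V] (Q : Set V) : Prop :=
  ∃ B C : Set V, IsPyramidWithBase Q B ∧ IsPyramidWithBase B C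

/-! ### Hyperbolic space in the projective (Beltrami-Klein) model -/

/-- Hyperbolic `n`-space: the open unit ball with the Klein metric. Its geodesic lines,
hyperplanes and half-spaces are the traces of the affine ones, and its points at infinity are the
points of the unit sphere. -/
def hypSpace (n : ℕ) : Set (EuclideanSpace ℝ (Fin n)) := Metric.ball 0 1

/-- The Lorentzian bilinear form on `ℝⁿ × ℝ`. -/
noncomputable def lorentz {n : ℕ} (u v : EuclideanSpace ℝ (Fin n) × ℝ) : ℝ :=
  inner ℝ u.1 v.1 - u.2 * v.2

/-- The hyperplane of hyperbolic space orthogonal to `e`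
(a genuine hyperplane when `0 < lorentz e e`). -/
def hypHyperplane {n : ℕ} (e : EuclideanSpace ℝ (Fin n) × ℝ) :
    Set (EuclideanSpace ℝ (Fin n)) :=
  {x ∈ hypSpace n | inner ℝ e.1 x = e.2}

/-- The closed half-space of hyperbolic space with outward normal `e`, consisting of those `x`
with `lorentz e (x, 1) ≤ 0` (a genuine half-space when `0 < lorentz e e`). -/
def hypHalfSpace {n : ℕ} (e : EuclideanSpace ℝ (Fin n) × ℝ) :
    Set (EuclideanSpace ℝ (Fin n)) :=
  {x ∈ hypSpace n | inner ℝ e.1 x ≤ e.2}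

/-- Hyperbolic volume of a subset of hyperbolic space: in the Klein model the volume element is
`(1 - ‖x‖²) ^ (-(n + 1) / 2) dx`. -/
noncomputable def hypVolume {n : ℕ} (P : Set (EuclideanSpace ℝ (Fin n))) : ENNReal :=
  ∫⁻ x in P ∩ hypSpace n, ENNReal.ofReal ((1 - ‖x‖ ^ 2) ^ (-((n : ℝ) + 1) / 2))

/-- The dimension of (the affine hull of) a nonempty set. -/
noncomputable def affDim {n : ℕ} (S : Set (EuclideanSpace ℝ (Fin n))) : ℕ :=
  Module.finrank ℝ (vectorSpan ℝ S)

/-- A (convex, `n`-dimensional) polytope of finite volume in hyperbolic `n`-space: a finite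
intersection of closed half-spaces with nonempty interior and finite hyperbolic volume. -/
structure IsHypPolytope {n : ℕ} (P : Set (EuclideanSpace ℝ (Fin n))) : Prop where
  exists_halfSpaces : ∃ S : Finset (EuclideanSpace ℝ (Fin n) × ℝ),
    (∀ e ∈ S, 0 < lorentz e e) ∧ P = {x ∈ hypSpace n | ∀ e ∈ S, x ∈ hypHalfSpace e}
  interior_nonempty : (interior P).Nonempty
  volume_lt_top : hypVolume P < ⊤

/-- The outward unit normals of the facets of `P`: the unit vectors `e` such that `P` lies in the
half-space of `e` and meets its boundary hyperplane in a set of dimension `n - 1`. -/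
def facetNormals {n : ℕ} (P : Set (EuclideanSpace ℝ (Fin n))) :
    Set (EuclideanSpace ℝ (Fin n) × ℝ) :=
  {e | lorentz e e = 1 ∧ P ⊆ hypHalfSpace e ∧ (P ∩ hypHyperplane e).Nonempty ∧
    affDim (P ∩ hypHyperplane e) + 1 = n}

/-- The facets of `P`. -/
def facets {n : ℕ} (P : Set (EuclideanSpace ℝ (Fin n))) :
    Set (Set (EuclideanSpace ℝ (Fin n))) :=
  (fun e => P ∩ hypHyperplane e) '' facetNormals P

/-- The facets of `P` with outward normals `e` and `f` are adjacent: they meet (inside hyperbolic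
space) in a face of dimension `n - 2`. -/
def FacetsAdjacent {n : ℕ} (P : Set (EuclideanSpace ℝ (Fin n)))
    (e f : EuclideanSpace ℝ (Fin n) × ℝ) : Prop :=
  (P ∩ hypHyperplane e ∩ hypHyperplane f).Nonempty ∧
    affDim (P ∩ hypHyperplane e ∩ hypHyperplane f) + 2 = n

/-- The dihedral angle `∈ [0, π]` of the intersection of two half-spaces with outward unit normals
`e` and `f` whose boundary hyperplanes intersect. -/
noncomputable def dihedralAngle {n : ℕ} (e f : EuclideanSpace ℝ (Fin n) × ℝ) : ℝ :=
  Real.arccos (-lorentz e f)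

/-- A hyperbolic Coxeter polytope: a polytope of finite volume, all of whose dihedral angles are
of the form `π / m` with an integer `m ≥ 2`. -/
structure IsCoxeterPolytope {n : ℕ} (P : Set (EuclideanSpace ℝ (Fin n))) : Prop
    extends IsHypPolytope P where
  dihedralAngle_eq : ∀ e ∈ facetNormals P, ∀ f ∈ facetNormals P, e ≠ f → FacetsAdjacent P e f →
    ∃ m : ℕ, 2 ≤ m ∧ dihedralAngle e f = Real.pi / m

/-- The polytope `P` together with its ideal vertices: its closure in the closed unit ball. The
combinatorial type of a polytope of finite volume is that of this Euclidean polytope. -/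
def completed {n : ℕ} (P : Set (EuclideanSpace ℝ (Fin n))) : Set (EuclideanSpace ℝ (Fin n)) :=
  closure P

/-! In the Klein model, finite volume makes the completed polytope `Q` a compact Euclidean polytope
in the closed ball. If the defining inequalities had a solution outside the ball, `P` would contain
a neighbourhood of an ideal point, which has infinite volume. Hence `Q` is cut out by an irredundant
finite set `M` of Lorentz-unit normals (`IsHypPolytope.exists_isFacetSystem`), in bijection with the
facets once `n ≥ 2` (`IsFacetSystem.ncard_facets`).

The only use of the angles is that they are at most `π / 2`. This gives nonpositive products for
adjacent facets, and `IsFacetSystem.lorentz_nonpos` extends it to all pairs when `n ≥ 3`. Normals of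
facets through two distinct points of `Q` are orthogonal to the midpoint, which is a genuine
hyperbolic point, so the form is positive definite on them. Together with nonpositive products and a
common open half-space this makes them independent. As they annihilate two points, there are at most
`n - 1` of them (`IsFacetSystem.card_add_one_le`).

For the first claim, `n + 2` normals in an `(n + 1)`-dimensional space satisfy a single linear
relation `c`. Up to scaling, `Q` is the set of nonnegative vectors `y ≠ 0` with `∑ c e * y e = 0`,
so its face lattice depends only on the numbers of positive, negative and zero coefficients.
Irredundance gives at least two of each sign. A zero coefficient yields a vertex on all facets but
one. Two such vertices would share `n` facets, so there is at most one zero. No zero gives the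
product, one zero the pyramid.

For the second claim, each of the two apexes of a multipyramid misses at most one facet and at most
`n - 1` facets contain both, so there are at most `n + 1` facets. Then the extreme points of `Q` are
affinely independent, and so the innermost base is a simplex, which is excluded. -/

/-! ### Systems of linear inequalities. -/

/-- Farkas' lemma for finitely many linear functionals. -/
theorem exists_nonneg_sum_smul_of_forall_nonpos {V ι : Type*} [AddCommGroup V] [Module ℝ V]
    [DecidableEq ι] (S : Finset ι) (f : ι → V →ₗ[ℝ] ℝ) (g : V →ₗ[ℝ] ℝ)
    (h : ∀ v, (∀ i ∈ S, f i v ≤ 0) → g v ≤ 0) :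
    ∃ c : ι → ℝ, (∀ i, 0 ≤ c i) ∧ g = ∑ i ∈ S, c i • f i := by
  induction S using Finset.induction_on generalizing f g with
  | empty =>
    refine ⟨0, fun _ => le_rfl, ?_⟩
    ext v
    have h1 := h v (by simp)
    have h2 := h (-v) (by simp)
    rw [map_neg] at h2
    simp only [Finset.sum_empty, LinearMap.zero_apply]
    linarith
  | insert j S hj ih =>
    by_cases hS : ∀ v, (∀ i ∈ S, f i v ≤ 0) → g v ≤ 0
    · obtain ⟨c, hc, hg⟩ := ih f g hS
      refine ⟨fun i => if i = j then 0 else c i, fun i => by dsimp only; split_ifs <;> simp [hc], ?_⟩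
      rw [Finset.sum_insert hj, hg]
      simp only [if_true, zero_smul, zero_add]
      refine Finset.sum_congr rfl fun i hi => ?_
      rw [if_neg (ne_of_mem_of_not_mem hi hj)]
    · push Not at hS
      obtain ⟨x, hx, hgx⟩ := hS
      have hjx : 0 < f j x := by
        by_contra hneg
        exact absurd (h x fun i hi => by
          rcases Finset.mem_insert.1 hi with rfl | hi
          · exact not_lt.1 hneg
          · exact hx i hi) (not_le.2 hgx)
      -- Compose every functional with the projection onto `ker (f j)` along `x`. The signs of `g x`
      -- and `f i x` then make the coefficient of `f j` nonnegative.
      obtain ⟨c, hc, hg⟩ := ih (fun i => f i - (f i x / f j x) • f j)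
        (g - (g x / f j x) • f j) (by
          intro v hv
          have := h (v - (f j v / f j x) • x) (by
            intro i hi
            rcases Finset.mem_insert.1 hi with rfl | hi
            · simp only [map_sub, map_smul, smul_eq_mul]
              rw [div_mul_cancel₀ _ hjx.ne', sub_self]
            · have := hv i hi
              simp only [LinearMap.sub_apply, LinearMap.smul_apply, smul_eq_mul] at this
              simp only [map_sub, map_smul, smul_eq_mul]
              calc _ = f i v - f i x / f j x * f j v := by ring
                _ ≤ 0 := this)
          simp only [LinearMap.sub_apply, LinearMap.smul_apply, smul_eq_mul]
          simp only [map_sub, map_smul, smul_eq_mul] at this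
          calc _ = g v - f j v / f j x * g x := by ring
            _ ≤ 0 := this)
      refine ⟨fun i => if i = j then g x / f j x - ∑ i ∈ S, c i * (f i x / f j x) else c i,
        fun i => ?_, ?_⟩
      · dsimp only
        split_ifs with hij
        · have h1 : ∑ i ∈ S, c i * (f i x / f j x) ≤ 0 :=
            Finset.sum_nonpos fun i hi =>
              mul_nonpos_of_nonneg_of_nonpos (hc i) (div_nonpos_of_nonpos_of_nonneg (hx i hi) hjx.le)
          have h2 : 0 < g x / f j x := div_pos hgx hjx
          linarith
        · exact hc i
      · rw [Finset.sum_insert hj]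
        simp only [if_true]
        have : ∑ i ∈ S, (if i = j then g x / f j x - ∑ i ∈ S, c i * (f i x / f j x) else c i) • f i
            = ∑ i ∈ S, c i • f i :=
          Finset.sum_congr rfl fun i hi => by rw [if_neg (ne_of_mem_of_not_mem hi hj)]
        have hg' : g = (g x / f j x) • f j + ∑ i ∈ S, c i • (f i - (f i x / f j x) • f j) := by
          rw [← hg]; abel
        rw [this]
        ext v
        have hv := LinearMap.congr_fun hg' v
        simp only [LinearMap.add_apply, LinearMap.sum_apply, LinearMap.sub_apply,
          LinearMap.smul_apply, smul_eq_mul, mul_sub, Finset.sum_sub_distrib] at hv ⊢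
        rw [hv, sub_mul, Finset.sum_mul]
        simp only [mul_assoc]
        ring

/-- A finite system of linear inequalities on a convex set has an irredundant subsystem; if the
system has a strict solution, each inequality of the subsystem can be made the only tight one. -/
theorem exists_irredundant {V ι : Type*} [AddCommGroup V] [Module ℝ V] [DecidableEq ι]
    {U : Set V} (hU : Convex ℝ U) (S : Finset ι) (f : ι → V →ₗ[ℝ] ℝ) {p : V} (hpU : p ∈ U)
    (hp : ∀ i ∈ S, f i p < 0) :
    ∃ M ⊆ S, (∀ v ∈ U, (∀ i ∈ M, f i v ≤ 0) → ∀ i ∈ S, f i v ≤ 0) ∧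
      ∀ i ∈ M, ∃ z ∈ U, f i z = 0 ∧ ∀ j ∈ M, j ≠ i → f j z < 0 := by
  induction S using Finset.strongInduction with
  | H S ih =>
    by_cases hred : ∃ i ∈ S, ∀ v ∈ U, (∀ j ∈ S.erase i, f j v ≤ 0) → f i v ≤ 0
    · obtain ⟨i, hi, hv⟩ := hred
      obtain ⟨M, hMS, hM, hz⟩ := ih (S.erase i) (Finset.erase_ssubset hi)
        fun j hj => hp j (Finset.mem_of_mem_erase hj)
      refine ⟨M, hMS.trans (Finset.erase_subset _ _), fun v hvU hvM j hj => ?_, hz⟩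
      have := hM v hvU hvM
      by_cases hji : j = i
      · exact hji ▸ hv v hvU this
      · exact this j (Finset.mem_erase.2 ⟨hji, hj⟩)
    · push Not at hred
      refine ⟨S, Finset.Subset.refl _, fun v _ h => h, fun i hi => ?_⟩
      obtain ⟨x, hxU, hx, hix⟩ := hred i hi
      have hpi := hp i hi
      have hd : 0 < f i x - f i p := by linarith
      -- The segment from `p` to `x` crosses `f i = 0` here. The weight of `p` is positive, so the
      -- other inequalities stay strict.
      refine ⟨(f i x / (f i x - f i p)) • p + (-f i p / (f i x - f i p)) • x,
        hU hpU hxU (by positivity) (div_nonneg (by linarith) hd.le) (by field_simp; ring), ?_, ?_⟩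
      · simp only [map_add, map_smul, smul_eq_mul]
        field_simp
        ring
      · intro j hj hji
        have h1 := hx j (Finset.mem_erase.2 ⟨hji, hj⟩)
        have h2 := hp j hj
        simp only [map_add, map_smul, smul_eq_mul]
        have h3 : 0 < f i x / (f i x - f i p) := div_pos hix hd
        have h4 : 0 ≤ -f i p / (f i x - f i p) := div_nonneg (by linarith) hd.le
        nlinarith [mul_neg_of_pos_of_neg h3 h2, mul_nonpos_of_nonneg_of_nonpos h4 h1]

/-- Strict linear inequalities are stable under small displacements. -/
theorem exists_pos_add_smul_nonpos {V ι : Type*} [AddCommGroup V] [Module ℝ V]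
    (S : Finset ι) (f : ι → V →ₗ[ℝ] ℝ) (z u : V)
    (h : ∀ i ∈ S, f i z < 0 ∨ (f i z = 0 ∧ f i u = 0)) :
    ∃ ε : ℝ, 0 < ε ∧ ∀ i ∈ S, f i (z + ε • u) ≤ 0 := by
  have key : ∀ᶠ ε : ℝ in nhdsWithin 0 (Set.Ioi 0), ∀ i ∈ S, f i (z + ε • u) ≤ 0 := by
    rw [Filter.eventually_all_finset]
    intro i hi
    simp only [map_add, map_smul, smul_eq_mul]
    rcases h i hi with h | ⟨h1, h2⟩
    · have hc : Filter.Tendsto (fun ε : ℝ => f i z + ε * f i u) (nhds 0)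
          (nhds (f i z + 0 * f i u)) := by
        apply Continuous.tendsto
        fun_prop
      rw [zero_mul, add_zero] at hc
      filter_upwards [nhdsWithin_le_nhds (hc.eventually (gt_mem_nhds h))] with ε hε using hε.le
    · simp [h1, h2]
  obtain ⟨ε, h1, h2⟩ := (key.and self_mem_nhdsWithin).exists
  exact ⟨ε, h2, h1⟩

/-! ### The Lorentzian form and cones over bounded sections. -/

theorem lorentz_comm {n : ℕ} (u v : EuclideanSpace ℝ (Fin n) × ℝ) :
    lorentz u v = lorentz v u := by
  rw [lorentz, lorentz, real_inner_comm, mul_comm]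

theorem lorentz_add_right {n : ℕ} (u v w : EuclideanSpace ℝ (Fin n) × ℝ) :
    lorentz u (v + w) = lorentz u v + lorentz u w := by
  simp only [lorentz, Prod.fst_add, Prod.snd_add, inner_add_right]
  ring

theorem lorentz_smul_right {n : ℕ} (c : ℝ) (u v : EuclideanSpace ℝ (Fin n) × ℝ) :
    lorentz u (c • v) = c * lorentz u v := by
  simp only [lorentz, Prod.smul_fst, Prod.smul_snd, real_inner_smul_right, smul_eq_mul]
  ring

/-- The Lorentzian form as a bilinear map. -/
noncomputable def lorentzForm (n : ℕ) : (EuclideanSpace ℝ (Fin n) × ℝ) →ₗ[ℝ]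
    (EuclideanSpace ℝ (Fin n) × ℝ) →ₗ[ℝ] ℝ :=
  LinearMap.mk₂ ℝ lorentz
    (fun u v w => by rw [lorentz_comm, lorentz_add_right, lorentz_comm w, lorentz_comm w])
    (fun c u v => by rw [lorentz_comm, lorentz_smul_right, lorentz_comm v, smul_eq_mul])
    lorentz_add_right lorentz_smul_right

theorem lorentzForm_apply {n : ℕ} (u v : EuclideanSpace ℝ (Fin n) × ℝ) :
    lorentzForm n u v = lorentz u v := rfl

theorem lorentzForm_injective (n : ℕ) : Function.Injective (lorentzForm n) := by
  rw [← LinearMap.ker_eq_bot, LinearMap.ker_eq_bot']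
  intro u hu
  have h1 := LinearMap.congr_fun hu (u.1, -u.2)
  simp only [lorentzForm_apply, lorentz, LinearMap.zero_apply, real_inner_self_eq_norm_sq] at h1
  have h2 : ‖u.1‖ = 0 := by nlinarith [sq_nonneg ‖u.1‖, sq_nonneg u.2]
  have h3 : u.2 = 0 := by nlinarith [sq_nonneg ‖u.1‖, sq_nonneg u.2]
  exact Prod.ext (norm_eq_zero.1 h2) h3

theorem fst_ne_zero_of_lorentz_pos {n : ℕ} {e : EuclideanSpace ℝ (Fin n) × ℝ}
    (he : 0 < lorentz e e) : e.1 ≠ 0 := by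
  intro h
  simp only [lorentz, h, inner_zero_left] at he
  nlinarith [sq_nonneg e.2]

theorem lorentz_mk_one {n : ℕ} (e : EuclideanSpace ℝ (Fin n) × ℝ) (x : EuclideanSpace ℝ (Fin n)) :
    lorentz e (x, 1) = inner ℝ e.1 x - e.2 := by
  simp [lorentz]

/-- If a section at height `1` of a polyhedral cone is bounded with a strict interior point, then
the whole cone lies at positive heights. -/
theorem snd_pos_of_forall_lorentz_nonpos {n : ℕ}
    (U : Submodule ℝ (EuclideanSpace ℝ (Fin n) × ℝ)) (S : Finset (EuclideanSpace ℝ (Fin n) × ℝ))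
    {R : ℝ} (hR : ∀ x : EuclideanSpace ℝ (Fin n), (x, (1 : ℝ)) ∈ U →
      (∀ f ∈ S, lorentz f (x, 1) ≤ 0) → ‖x‖ ≤ R)
    {p : EuclideanSpace ℝ (Fin n)} (hpU : (p, (1 : ℝ)) ∈ U) (hp : ∀ f ∈ S, lorentz f (p, 1) < 0)
    (hU : ∃ u : EuclideanSpace ℝ (Fin n), u ≠ 0 ∧ (u, (0 : ℝ)) ∈ U)
    {v : EuclideanSpace ℝ (Fin n) × ℝ} (hvU : v ∈ U) (hv0 : v ≠ 0)
    (hv : ∀ f ∈ S, lorentz f v ≤ 0) : 0 < v.2 := by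
  have ray : ∀ u : EuclideanSpace ℝ (Fin n), (u, (0 : ℝ)) ∈ U →
      (∀ f ∈ S, lorentz f (u, 0) ≤ 0) → u = 0 := by
    intro u huU hu
    by_contra hne
    have hpos : 0 < ‖u‖ := norm_pos_iff.2 hne
    have hmem : ∀ t : ℝ, 0 ≤ t → ‖p + t • u‖ ≤ R := by
      intro t ht
      have heq : ((p + t • u, (1 : ℝ)) : EuclideanSpace ℝ (Fin n) × ℝ) = (p, 1) + t • (u, 0) := by
        simp
      refine hR _ (heq ▸ U.add_mem hpU (U.smul_mem t huU)) fun f hf => ?_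
      rw [heq, lorentz_add_right, lorentz_smul_right]
      nlinarith [hp f hf, mul_nonneg ht (neg_nonneg.2 (hu f hf))]
    have hR0 : 0 ≤ R := (norm_nonneg _).trans (hmem 0 le_rfl)
    have h1 := hmem ((R + ‖p‖ + 1) / ‖u‖) (by positivity)
    have h2 : ‖((R + ‖p‖ + 1) / ‖u‖) • u‖ = R + ‖p‖ + 1 := by
      rw [norm_smul, Real.norm_of_nonneg (by positivity)]
      field_simp
    have h3 := norm_sub_le (p + ((R + ‖p‖ + 1) / ‖u‖) • u) p
    rw [add_sub_cancel_left, h2] at h3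
    linarith
  by_contra hneg
  have hs : 0 ≤ -v.2 := by linarith [not_lt.1 hneg]
  -- A cone vector at height at most `0` is pushed up to height `0` by a multiple of `(p, 1)`. The
  -- result is a recession direction of a bounded section, hence zero.
  have heq : v + (-v.2) • (p, (1 : ℝ)) = (v.1 + (-v.2) • p, 0) := by
    ext <;> simp
  have hle : ∀ f ∈ S, lorentz f (v + (-v.2) • (p, (1 : ℝ))) ≤ 0 := by
    intro f hf
    rw [lorentz_add_right, lorentz_smul_right]
    nlinarith [hv f hf, mul_nonneg hs (neg_nonneg.2 (hp f hf).le)]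
  have h0 := ray (v.1 + (-v.2) • p) (heq ▸ U.add_mem hvU (U.smul_mem _ hpU))
    (fun f hf => heq ▸ hle f hf)
  rw [h0] at heq
  have hveq : v = v.2 • (p, (1 : ℝ)) := by
    have := eq_neg_of_add_eq_zero_left (heq.trans Prod.mk_zero_zero)
    rw [this, neg_smul, neg_neg]
    simp
  have hv2 : v.2 ≠ 0 := fun h => hv0 (by rw [hveq, h, zero_smul])
  have hneg' : 0 < -v.2 := lt_of_le_of_ne hs (by simpa using hv2)
  -- Now `v` is a negative multiple of `(p, 1)`, which contradicts any strict inequality at `p`.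
  -- Only `S = ∅` is left, and there every horizontal vector is a recession direction.
  obtain ⟨u, hu, huU⟩ := hU
  refine hu (ray u huU fun f hf => ?_)
  have h1 := hv f hf
  rw [hveq, lorentz_smul_right] at h1
  nlinarith [hp f hf]

/-! ### Finite volume and the closed ball. -/

open scoped Pointwise in
/-- A set containing a neighbourhood (within hyperbolic space) of an ideal point has infinite
hyperbolic volume. -/
theorem hypVolume_eq_top_of_ball_subset {n : ℕ} {P : Set (EuclideanSpace ℝ (Fin n))}
    {z : EuclideanSpace ℝ (Fin n)} (hz : ‖z‖ = 1) {r : ℝ} (hr : 0 < r)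
    (h : Metric.ball z r ∩ hypSpace n ⊆ P) : hypVolume P = ⊤ := by
  by_contra hfin
  have hn : 1 ≤ n := by
    rcases Nat.eq_zero_or_pos n with rfl | hn
    · rw [Subsingleton.elim z 0, norm_zero] at hz
      exact absurd hz zero_ne_one
    · exact hn
  set ρ : EuclideanSpace ℝ (Fin n) → ENNReal :=
    fun x => ENNReal.ofReal ((1 - ‖x‖ ^ 2) ^ (-((n : ℝ) + 1) / 2)) with hρ
  have hρm : Measurable ρ := by
    apply ENNReal.measurable_ofReal.comp
    exact Measurable.pow_const (by fun_prop) _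
  set ν := MeasureTheory.volume.withDensity ρ with hν
  have hνP : ν (P ∩ hypSpace n) ≠ ⊤ := by
    rw [hν, MeasureTheory.withDensity_apply']
    exact hfin
  -- A solid sector around the direction `z`. Its part `A ε` within `ε` of the sphere has Euclidean
  -- volume at least `ε * v` and density at least `1 / (2 * ε)`, so its measure stays above `v / 2`.
  -- In a set of finite measure these shells, which decrease to `∅`, would have measure tending to
  -- `0`.
  set C : Set (EuclideanSpace ℝ (Fin n)) :=
    {x | x ≠ 0 ∧ ‖x‖ < 1 ∧ dist (‖x‖⁻¹ • x) z < r / 2} with hC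
  have hCm : MeasurableSet C := by
    refine (measurableSet_singleton (0 : EuclideanSpace ℝ (Fin n))).compl.inter
      ((measurableSet_lt measurable_norm measurable_const).inter
        (measurableSet_lt (Measurable.dist ?_ measurable_const) measurable_const))
    exact (measurable_norm.inv).smul measurable_id
  have hz0 : z ≠ 0 := fun h0 => by simp [h0] at hz
  have hCpos : MeasureTheory.volume C ≠ 0 := by
    refine (MeasureTheory.Measure.measure_pos_of_mem_nhds _ (x := (2 : ℝ)⁻¹ • z) ?_).ne'
    have hnz : ‖(2 : ℝ)⁻¹ • z‖ = 2⁻¹ := by rw [norm_smul, hz]; norm_num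
    have h0 : (2 : ℝ)⁻¹ • z ≠ 0 := smul_ne_zero (by norm_num) hz0
    have hcont : ContinuousAt (fun x : EuclideanSpace ℝ (Fin n) => dist (‖x‖⁻¹ • x) z)
        ((2 : ℝ)⁻¹ • z) := by
      exact Filter.Tendsto.dist (ContinuousAt.smul (ContinuousAt.inv₀ continuous_norm.continuousAt
        (norm_ne_zero_iff.2 h0)) continuousAt_id) tendsto_const_nhds
    refine Filter.inter_mem (isOpen_ne.mem_nhds h0) (Filter.inter_mem ?_ ?_)
    · exact (isOpen_lt continuous_norm continuous_const).mem_nhds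
        (by show ‖(2 : ℝ)⁻¹ • z‖ < 1; rw [hnz]; norm_num)
    · refine hcont.eventually (gt_mem_nhds ?_)
      simp only [hnz, inv_inv, smul_smul]
      norm_num
      exact hr
  have hCtop : MeasureTheory.volume C ≠ ⊤ := by
    refine ne_top_of_le_ne_top (MeasureTheory.measure_ball_lt_top (x := 0) (r := 1)).ne
      (MeasureTheory.measure_mono ?_)
    rintro x ⟨-, hx, -⟩
    simpa using hx
  set v := (MeasureTheory.volume C).toReal with hv
  have hvC : MeasureTheory.volume C = ENNReal.ofReal v := (ENNReal.ofReal_toReal hCtop).symm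
  have hvpos : 0 < v := ENNReal.toReal_pos hCpos hCtop
  set A : ℝ → Set (EuclideanSpace ℝ (Fin n)) := fun ε => C ∩ {x | 1 - ε ≤ ‖x‖} with hA
  have hAm : ∀ ε, MeasurableSet (A ε) := fun ε =>
    hCm.inter (measurableSet_le measurable_const measurable_norm)
  have hvolA : ∀ ε, 0 < ε → ε < 1 → ENNReal.ofReal (ε * v) ≤ MeasureTheory.volume (A ε) := by
    intro ε hε hε1
    -- Radial scaling bounds the volume of the shell from below, since `(1 - ε) ^ n ≤ 1 - ε` for `n
    -- ≥ 1`.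
    have hsub : C ⊆ A ε ∪ (1 - ε) • C := by
      intro x hx
      by_cases hxn : 1 - ε ≤ ‖x‖
      · exact Or.inl ⟨hx, hxn⟩
      · right
        have hne : (1 - ε) ≠ 0 := by linarith
        rw [Set.mem_smul_set_iff_inv_smul_mem₀ hne]
        have hpos : 0 < (1 - ε)⁻¹ := by rw [inv_pos]; linarith
        have hn' : ‖(1 - ε)⁻¹ • x‖ = (1 - ε)⁻¹ * ‖x‖ := by
          rw [norm_smul, Real.norm_of_nonneg hpos.le]
        refine ⟨smul_ne_zero hpos.ne' hx.1, ?_, ?_⟩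
        · rw [hn', inv_mul_lt_iff₀ (by linarith)]
          linarith [not_le.1 hxn]
        · rw [hn', smul_smul]
          have : ((1 - ε)⁻¹ * ‖x‖)⁻¹ * (1 - ε)⁻¹ = ‖x‖⁻¹ := by
            rw [mul_inv, mul_comm, ← mul_assoc, inv_inv, inv_mul_cancel₀ hne, one_mul]
          rw [this]
          exact hx.2.2
    have h1 := (MeasureTheory.measure_mono (μ := MeasureTheory.volume) hsub).trans
      (MeasureTheory.measure_union_le _ _)
    rw [MeasureTheory.Measure.addHaar_smul, finrank_euclideanSpace_fin, hvC,
      ← ENNReal.ofReal_mul (abs_nonneg _)] at h1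
    have h2 : |(1 - ε) ^ n| * v ≤ (1 - ε) * v := by
      rw [abs_of_nonneg (pow_nonneg (by linarith) _)]
      exact mul_le_mul_of_nonneg_right (pow_le_of_le_one (by linarith) (by linarith) (by omega))
        hvpos.le
    have h3 := h1.trans (add_le_add le_rfl (ENNReal.ofReal_le_ofReal h2))
    have h4 : ENNReal.ofReal v = ENNReal.ofReal (ε * v) + ENNReal.ofReal ((1 - ε) * v) := by
      rw [← ENNReal.ofReal_add (by positivity) (mul_nonneg (by linarith) hvpos.le)]
      congr 1
      ring
    rw [h4] at h3
    exact (ENNReal.add_le_add_iff_right ENNReal.ofReal_ne_top).1 h3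
  have hνA : ∀ ε, 0 < ε → ε < 1 → ENNReal.ofReal (v / 2) ≤ ν (A ε) := by
    intro ε hε hε1
    have hle : ∀ x ∈ A ε, ENNReal.ofReal (1 / (2 * ε)) ≤ ρ x := by
      rintro x ⟨⟨-, hx1, -⟩, hx2⟩
      have hx2' : 1 - ε ≤ ‖x‖ := hx2
      have hb : 0 < 1 - ‖x‖ ^ 2 := by nlinarith [norm_nonneg x]
      have hb1 : 1 - ‖x‖ ^ 2 ≤ 1 := by nlinarith [norm_nonneg x]
      refine ENNReal.ofReal_le_ofReal ?_
      have hn' : (1 : ℝ) ≤ n := by exact_mod_cast hn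
      calc 1 / (2 * ε) ≤ 1 / (1 - ‖x‖ ^ 2) :=
            one_div_le_one_div_of_le hb (by nlinarith [norm_nonneg x])
        _ = (1 - ‖x‖ ^ 2) ^ (-1 : ℝ) := by rw [Real.rpow_neg_one, one_div]
        _ ≤ _ := Real.rpow_le_rpow_of_exponent_ge hb hb1 (by linarith)
    rw [hν, MeasureTheory.withDensity_apply']
    calc ENNReal.ofReal (v / 2) = ENNReal.ofReal (1 / (2 * ε)) * ENNReal.ofReal (ε * v) := by
          rw [← ENNReal.ofReal_mul (by positivity)]
          congr 1
          field_simp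
      _ ≤ ENNReal.ofReal (1 / (2 * ε)) * MeasureTheory.volume (A ε) := by
          gcongr
          exact hvolA ε hε hε1
      _ ≤ _ := by
          rw [← MeasureTheory.setLIntegral_const]
          exact MeasureTheory.setLIntegral_mono hρm hle
  -- The bound `r / 2` keeps the shell in the ball around `z`, because radial projection moves its
  -- points by at most `ε`. The bound `1 / 2` ensures `ε < 1`.
  set δ := min (r / 2) (1 / 2) with hδ
  have hδ0 : 0 < δ := by positivity
  have hAP : ∀ ε, ε ≤ δ → A ε ⊆ P ∩ hypSpace n := by
    rintro ε hε x ⟨⟨hx0, hx1, hx2⟩, hx3⟩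
    have hx3' : 1 - ε ≤ ‖x‖ := hx3
    have hxh : x ∈ hypSpace n := by simpa [hypSpace] using hx1
    refine ⟨h ⟨?_, hxh⟩, hxh⟩
    have hxn : ‖x‖ ≠ 0 := norm_ne_zero_iff.2 hx0
    have h1 : dist x (‖x‖⁻¹ • x) = 1 - ‖x‖ := by
      have : x - ‖x‖⁻¹ • x = (1 - ‖x‖⁻¹) • x := by rw [sub_smul, one_smul]
      rw [dist_eq_norm, this, norm_smul, ← Real.norm_of_nonneg (norm_nonneg x), Real.norm_eq_abs,
        Real.norm_eq_abs, abs_norm, ← abs_norm x, ← abs_mul, abs_norm, sub_mul,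
        inv_mul_cancel₀ hxn, one_mul, abs_sub_comm, abs_of_nonneg (by linarith)]
    have h2 := dist_triangle x (‖x‖⁻¹ • x) z
    have h3 : δ ≤ r / 2 := min_le_left _ _
    show dist x z < r
    linarith
  set ε : ℕ → ℝ := fun k => δ / (k + 1) with hε
  have hεpos : ∀ k, 0 < ε k := fun k => by positivity
  have hεle : ∀ k, ε k ≤ δ := fun k =>
    div_le_self hδ0.le (by linarith [(Nat.cast_nonneg k : (0 : ℝ) ≤ k)])
  have hεlim : Filter.Tendsto ε Filter.atTop (nhds 0) := by
    have := (tendsto_one_div_add_atTop_nhds_zero_nat (𝕜 := ℝ)).const_mul δ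
    simpa [hε, div_eq_mul_inv] using this
  have hanti : Antitone fun k => A (ε k) := by
    rintro i j hij x ⟨hx1, hx2⟩
    have h1 : 1 - ε j ≤ ‖x‖ := hx2
    have h2 : ε j ≤ ε i := by
      simp only [hε]
      gcongr
    exact ⟨hx1, show 1 - ε i ≤ ‖x‖ by linarith⟩
  have hlim := MeasureTheory.tendsto_measure_iInter_atTop (μ := ν)
    (fun k => (hAm (ε k)).nullMeasurableSet) hanti
    ⟨0, ne_top_of_le_ne_top hνP (MeasureTheory.measure_mono (hAP _ (hεle 0)))⟩
  have hempty : ⋂ k, A (ε k) = ∅ := by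
    refine Set.eq_empty_of_forall_notMem fun x hx => ?_
    rw [Set.mem_iInter] at hx
    have hx1 : 1 ≤ ‖x‖ := by
      have := hεlim.const_sub 1
      rw [sub_zero] at this
      exact le_of_tendsto this (Filter.Eventually.of_forall fun k => (hx k).2)
    exact absurd (hx 0).1.2.1 (not_lt.2 hx1)
  rw [hempty, MeasureTheory.measure_empty] at hlim
  have hge : ENNReal.ofReal (v / 2) ≤ 0 := ge_of_tendsto hlim (Filter.Eventually.of_forall fun k =>
    hνA _ (hεpos k) (lt_of_le_of_lt (hεle k) (lt_of_le_of_lt (min_le_right _ _) (by norm_num))))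
  rw [nonpos_iff_eq_zero, ENNReal.ofReal_eq_zero] at hge
  linarith

/-- `M` is an irredundant system of Lorentz-unit outward normals of the compact convex body `Q`
of the closed unit ball. -/
structure IsFacetSystem {n : ℕ} (M : Finset (EuclideanSpace ℝ (Fin n) × ℝ))
    (Q : Set (EuclideanSpace ℝ (Fin n))) : Prop where
  norm_le : ∀ x ∈ Q, ‖x‖ ≤ 1
  mem_iff : ∀ x, x ∈ Q ↔ ∀ e ∈ M, lorentz e (x, 1) ≤ 0
  exists_interior : ∃ p, ∀ e ∈ M, lorentz e (p, 1) < 0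
  exists_facet_point : ∀ e ∈ M, ∃ z, lorentz e (z, 1) = 0 ∧
    ∀ f ∈ M, f ≠ e → lorentz f (z, 1) < 0
  lorentz_self : ∀ e ∈ M, lorentz e e = 1

theorem lorentz_smul_left {n : ℕ} (c : ℝ) (u v : EuclideanSpace ℝ (Fin n) × ℝ) :
    lorentz (c • u) v = c * lorentz u v := by
  rw [lorentz_comm, lorentz_smul_right, lorentz_comm]

theorem mk_add_smul_one {n : ℕ} (x u : EuclideanSpace ℝ (Fin n)) (ε : ℝ) :
    ((x + ε • u, (1 : ℝ)) : EuclideanSpace ℝ (Fin n) × ℝ) = (x, 1) + ε • (u, 0) := by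
  simp

theorem convex_lorentz_nonpos {n : ℕ} (S : Finset (EuclideanSpace ℝ (Fin n) × ℝ)) :
    Convex ℝ {x : EuclideanSpace ℝ (Fin n) | ∀ e ∈ S, lorentz e (x, 1) ≤ 0} := by
  intro x hx y hy a b ha hb hab e he
  have h1 := hx e he
  have h2 := hy e he
  rw [lorentz_mk_one] at h1 h2 ⊢
  rw [inner_add_right, real_inner_smul_right, real_inner_smul_right]
  have : e.2 = (a + b) * e.2 := by rw [hab, one_mul]
  rw [this]
  nlinarith [mul_nonneg ha (neg_nonneg.2 h1), mul_nonneg hb (neg_nonneg.2 h2)]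

/-- The linear inequalities defining a polytope of finite volume already force its points to lie
in the closed unit ball. -/
theorem norm_le_one_of_hypVolume_lt_top {n : ℕ} {S : Finset (EuclideanSpace ℝ (Fin n) × ℝ)}
    {P : Set (EuclideanSpace ℝ (Fin n))}
    (hP : ∀ x, x ∈ P ↔ ‖x‖ < 1 ∧ ∀ e ∈ S, lorentz e (x, 1) ≤ 0) (hvol : hypVolume P < ⊤)
    {p : EuclideanSpace ℝ (Fin n)} (hp1 : ‖p‖ < 1) (hp : ∀ e ∈ S, lorentz e (p, 1) < 0)
    {q : EuclideanSpace ℝ (Fin n)} (hq : ∀ e ∈ S, lorentz e (q, 1) ≤ 0) : ‖q‖ ≤ 1 := by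
  by_contra hq1
  rw [not_le] at hq1
  -- The segment from `p` to `q` leaves the ball at an ideal point `z` distinct from `q`. All
  -- inequalities are still strict there, so `P` contains a hyperbolic neighbourhood of `z`.
  have hivt := intermediate_value_Icc (zero_le_one' ℝ)
    (f := fun t : ℝ => ‖p + t • (q - p)‖) (by fun_prop)
  obtain ⟨t, ⟨ht0, ht1⟩, ht⟩ := hivt (show (1 : ℝ) ∈ _ by
    simp only [zero_smul, add_zero, one_smul, add_sub_cancel, Set.mem_Icc]
    exact ⟨hp1.le, hq1.le⟩)
  have ht : ‖p + t • (q - p)‖ = 1 := ht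
  have ht1' : t < 1 := by
    refine lt_of_le_of_ne ht1 fun h => ?_
    rw [h, one_smul, add_sub_cancel] at ht
    linarith
  set z := p + t • (q - p) with hz
  have hstrict : ∀ e ∈ S, lorentz e (z, 1) < 0 := by
    intro e he
    have h1 := hp e he
    have h2 := hq e he
    rw [lorentz_mk_one] at h1 h2 ⊢
    rw [hz, inner_add_right, real_inner_smul_right, inner_sub_right]
    nlinarith [mul_pos (sub_pos.2 ht1') (neg_pos.2 h1), mul_nonneg ht0 (neg_nonneg.2 h2)]
  have hopen : ∀ᶠ x in nhds z, ∀ e ∈ S, lorentz e (x, 1) < 0 := by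
    rw [Filter.eventually_all_finset]
    intro e he
    have hc : Continuous fun x : EuclideanSpace ℝ (Fin n) => lorentz e (x, 1) := by
      simp only [lorentz_mk_one]
      fun_prop
    exact hc.continuousAt.eventually (gt_mem_nhds (hstrict e he))
  obtain ⟨r, hr, hball⟩ := Metric.eventually_nhds_iff_ball.1 hopen
  refine hvol.ne (hypVolume_eq_top_of_ball_subset ht hr ?_)
  rintro x ⟨hx1, hx2⟩
  exact (hP x).2 ⟨by simpa [hypSpace] using hx2, fun e he => (hball x hx1 e he).le⟩

/-- Finite volume confines all solutions of the inequalities to the closed ball, and contracting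
them towards an interior point shows that they form exactly the closure of `P`. The facet system
comes from normalising the given normals and discarding redundant ones. -/
theorem IsHypPolytope.exists_isFacetSystem {n : ℕ} {P : Set (EuclideanSpace ℝ (Fin n))}
    (hP : IsHypPolytope P) :
    ∃ M, IsFacetSystem M (closure P) ∧ P = closure P ∩ hypSpace n := by
  classical
  obtain ⟨S, hS, hPS⟩ := hP.exists_halfSpaces
  obtain ⟨p, hp⟩ := hP.interior_nonempty
  have hmem : ∀ x, x ∈ P ↔ ‖x‖ < 1 ∧ ∀ e ∈ S, lorentz e (x, 1) ≤ 0 := by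
    intro x
    rw [hPS]
    constructor
    · rintro ⟨h1, h2⟩
      refine ⟨by simpa [hypSpace] using h1, fun e he => ?_⟩
      rw [lorentz_mk_one]
      linarith [(h2 e he).2]
    · rintro ⟨h1, h2⟩
      have h1' : x ∈ hypSpace n := by simpa [hypSpace] using h1
      refine ⟨h1', fun e he => ⟨h1', ?_⟩⟩
      have := h2 e he
      rw [lorentz_mk_one] at this
      linarith
  have hp1 : ‖p‖ < 1 := ((hmem p).1 (interior_subset hp)).1
  have hpS : ∀ e ∈ S, lorentz e (p, 1) < 0 := by
    intro e he
    -- An interior point can be moved a little in the direction `e.1` without leaving `P`, so the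
    -- inequality of `e` is strict at it.
    have he0 := fst_ne_zero_of_lorentz_pos (hS e he)
    have hc : ContinuousAt (fun t : ℝ => p + t • e.1) 0 := by fun_prop
    have h1 : ∀ᶠ t : ℝ in nhds 0, p + t • e.1 ∈ P := by
      have : interior P ∈ nhds (p + (0 : ℝ) • e.1) := by
        rw [zero_smul, add_zero]
        exact isOpen_interior.mem_nhds hp
      filter_upwards [hc this] with t ht using interior_subset ht
    have h2 : ∀ᶠ t : ℝ in nhdsWithin 0 (Set.Ioi 0), p + t • e.1 ∈ P := nhdsWithin_le_nhds h1
    obtain ⟨t, ht, ht0⟩ := (h2.and self_mem_nhdsWithin).exists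
    have ht0 : 0 < t := ht0
    have h3 := ((hmem _).1 ht).2 e he
    rw [lorentz_mk_one, inner_add_right, real_inner_smul_right] at h3
    rw [lorentz_mk_one]
    have : 0 < inner ℝ e.1 e.1 := real_inner_self_pos.2 he0
    nlinarith [mul_pos ht0 this]
  have hnorm : ∀ q : EuclideanSpace ℝ (Fin n), (∀ e ∈ S, lorentz e (q, 1) ≤ 0) → ‖q‖ ≤ 1 :=
    fun q hq => norm_le_one_of_hypVolume_lt_top hmem hP.volume_lt_top hp1 hpS hq
  have hcl : ∀ x, x ∈ closure P ↔ ∀ e ∈ S, lorentz e (x, 1) ≤ 0 := by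
    intro x
    constructor
    · have hclosed : IsClosed {x : EuclideanSpace ℝ (Fin n) | ∀ e ∈ S, lorentz e (x, 1) ≤ 0} := by
        simp only [Set.ofPred_forall]
        refine isClosed_biInter fun e _ => isClosed_le ?_ continuous_const
        simp only [lorentz_mk_one]
        fun_prop
      exact fun hx => closure_minimal (fun y hy => ((hmem y).1 hy).2) hclosed hx
    · intro hx
      have hc : Filter.Tendsto (fun t : ℝ => x + t • (p - x)) (nhdsWithin 0 (Set.Ioo 0 1))
          (nhds x) := by
        have : ContinuousAt (fun t : ℝ => x + t • (p - x)) 0 := by fun_prop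
        have h := this.tendsto
        rw [zero_smul, add_zero] at h
        exact h.mono_left nhdsWithin_le_nhds
      have hne : (nhdsWithin (0 : ℝ) (Set.Ioo 0 1)).NeBot :=
        left_nhdsWithin_Ioo_neBot zero_lt_one
      refine mem_closure_of_tendsto hc ?_
      filter_upwards [self_mem_nhdsWithin] with t ht
      have heq : x + t • (p - x) = (1 - t) • x + t • p := by module
      have ht1 : 0 < 1 - t := by linarith [ht.2]
      refine (hmem _).2 ⟨?_, ?_⟩
      · rw [heq]
        refine (norm_add_le _ _).trans_lt ?_
        rw [norm_smul, norm_smul, Real.norm_of_nonneg ht1.le, Real.norm_of_nonneg ht.1.le]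
        nlinarith [hnorm x hx, ht.1]
      · rw [heq]
        exact convex_lorentz_nonpos S hx (fun e he => (hpS e he).le) ht1.le ht.1.le (by ring)
  set ν : EuclideanSpace ℝ (Fin n) × ℝ → EuclideanSpace ℝ (Fin n) × ℝ :=
    fun e => (Real.sqrt (lorentz e e))⁻¹ • e with hν
  have hsqrt : ∀ e ∈ S, 0 < (Real.sqrt (lorentz e e))⁻¹ := fun e he =>
    inv_pos.2 (Real.sqrt_pos.2 (hS e he))
  have hU : Convex ℝ {v : EuclideanSpace ℝ (Fin n) × ℝ | v.2 = 1} := by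
    intro v hv w hw a b _ _ hab
    simp only [Set.mem_ofPred_eq] at hv hw
    simp [hv, hw, hab]
  obtain ⟨M, hMS, hM, hMz⟩ := exists_irredundant hU (S.image ν) (fun e => lorentzForm n e)
    (p := (p, 1)) rfl (by
      intro e he
      obtain ⟨e, heS, rfl⟩ := Finset.mem_image.1 he
      rw [lorentzForm_apply, lorentz_smul_left]
      exact mul_neg_of_pos_of_neg (hsqrt e heS) (hpS e heS))
  refine ⟨M, ⟨?_, ?_, ⟨p, ?_⟩, ?_, ?_⟩, ?_⟩
  · exact fun x hx => hnorm x ((hcl x).1 hx)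
  · intro x
    rw [hcl]
    constructor
    · intro hx e he
      obtain ⟨e, heS, rfl⟩ := Finset.mem_image.1 (hMS he)
      rw [lorentz_smul_left]
      exact mul_nonpos_of_nonneg_of_nonpos (hsqrt e heS).le (hx e heS)
    · intro hx e he
      have := hM (x, 1) rfl hx (ν e) (Finset.mem_image_of_mem _ he)
      rw [lorentzForm_apply, lorentz_smul_left] at this
      exact nonpos_of_mul_nonpos_right this (hsqrt e he)
  · intro e he
    obtain ⟨e, heS, rfl⟩ := Finset.mem_image.1 (hMS he)
    rw [lorentz_smul_left]
    exact mul_neg_of_pos_of_neg (hsqrt e heS) (hpS e heS)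
  · intro e he
    obtain ⟨z, hz1, hz2, hz3⟩ := hMz e he
    have hz : z = (z.1, 1) := Prod.ext rfl hz1
    rw [hz] at hz2 hz3
    exact ⟨z.1, hz2, hz3⟩
  · intro e he
    obtain ⟨e, heS, rfl⟩ := Finset.mem_image.1 (hMS he)
    rw [lorentz_smul_left, lorentz_smul_right, ← mul_assoc, ← mul_inv,
      Real.mul_self_sqrt (hS e heS).le, inv_mul_cancel₀ (hS e heS).ne']
  · ext x
    rw [hmem, Set.mem_inter_iff, hcl, and_comm]
    simp [hypSpace]

/-! ### Dimensions of faces; normals versus facets. -/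

theorem mem_span_orthogonal_iff {E : Type*} [NormedAddCommGroup E] [InnerProductSpace ℝ E]
    (s : Set E) (u : E) : u ∈ (Submodule.span ℝ s)ᗮ ↔ ∀ w ∈ s, inner ℝ w u = 0 := by
  rw [Submodule.mem_orthogonal]
  refine ⟨fun h w hw => h w (Submodule.subset_span hw), fun h w hw => ?_⟩
  induction hw using Submodule.span_induction with
  | mem w hw => exact h w hw
  | zero => exact inner_zero_left _
  | add x y _ _ hx hy => rw [inner_add_left, hx, hy, add_zero]
  | smul c x _ hx => rw [real_inner_smul_left, hx, mul_zero]

theorem vectorSpan_eq_of_forall_exists_add_smul_mem {E : Type*} [AddCommGroup E] [Module ℝ E]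
    {A : Set E} {U : Submodule ℝ E} {z : E} (hz : z ∈ A) (h1 : ∀ x ∈ A, x - z ∈ U)
    (h2 : ∀ u ∈ U, ∃ ε : ℝ, 0 < ε ∧ z + ε • u ∈ A) : vectorSpan ℝ A = U := by
  apply le_antisymm
  · rw [vectorSpan_eq_span_vsub_set_right ℝ hz, Submodule.span_le]
    rintro _ ⟨x, hx, rfl⟩
    exact h1 x hx
  · intro u hu
    obtain ⟨ε, hε, hm⟩ := h2 u hu
    have := vsub_mem_vectorSpan ℝ hm hz
    rw [vsub_eq_sub, add_sub_cancel_left] at this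
    exact (Submodule.smul_mem_iff _ hε.ne').1 this

theorem lorentz_mk_zero {n : ℕ} (e : EuclideanSpace ℝ (Fin n) × ℝ) (u : EuclideanSpace ℝ (Fin n)) :
    lorentz e (u, 0) = inner ℝ e.1 u := by
  simp [lorentz]

/-- Convex combinations with positive coefficients of two points of the closed unit ball lie in
the open ball. -/
theorem norm_lt_one_of_add_smul {E : Type*} [NormedAddCommGroup E] [InnerProductSpace ℝ E]
    {z u : E} (hu : u ≠ 0) {ε δ : ℝ} (hε : 0 < ε) (hδ : 0 < δ) (h1 : ‖z + ε • u‖ ≤ 1)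
    (h2 : ‖z + δ • -u‖ ≤ 1) : ‖z‖ < 1 := by
  have hne : z + ε • u ≠ z + δ • -u := by
    intro h
    have h3 : (ε + δ) • u = 0 := by
      have := sub_eq_zero.2 h
      rw [← this]
      module
    exact hu ((smul_eq_zero.1 h3).resolve_left (by positivity))
  have h3 := norm_combo_lt_of_ne h1 h2 hne (a := δ / (ε + δ)) (b := ε / (ε + δ))
    (by positivity) (by positivity) (by field_simp; ring)
  have h4 : (δ / (ε + δ)) • (z + ε • u) + (ε / (ε + δ)) • (z + δ • -u) = z := by
    have : z = (δ / (ε + δ) + ε / (ε + δ)) • z := by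
      rw [← add_div, add_comm, div_self (by positivity), one_smul]
    conv_rhs => rw [this]
    module
  rwa [h4] at h3

/-- The directions of a face of a polytope, cut out by the equations `T` and the inequalities `N`,
which has a relative interior point. -/
theorem vectorSpan_eq_span_orthogonal {n : ℕ} {A : Set (EuclideanSpace ℝ (Fin n))}
    {T N : Finset (EuclideanSpace ℝ (Fin n) × ℝ)}
    (hA : ∀ x, x ∈ A ↔ ‖x‖ < 1 ∧ (∀ e ∈ T, lorentz e (x, 1) = 0) ∧ ∀ f ∈ N, lorentz f (x, 1) ≤ 0)
    (hnorm : ∀ x : EuclideanSpace ℝ (Fin n), (∀ e ∈ T, lorentz e (x, 1) = 0) →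
      (∀ f ∈ N, lorentz f (x, 1) ≤ 0) → ‖x‖ ≤ 1)
    {z : EuclideanSpace ℝ (Fin n)} (hzT : ∀ e ∈ T, lorentz e (z, 1) = 0)
    (hzN : ∀ f ∈ N, lorentz f (z, 1) < 0)
    (hU : (Submodule.span ℝ (Prod.fst '' (T : Set (EuclideanSpace ℝ (Fin n) × ℝ))))ᗮ ≠ ⊥) :
    z ∈ A ∧ vectorSpan ℝ A =
      (Submodule.span ℝ (Prod.fst '' (T : Set (EuclideanSpace ℝ (Fin n) × ℝ))))ᗮ := by
  have hmem : ∀ u, u ∈ (Submodule.span ℝ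
      (Prod.fst '' (T : Set (EuclideanSpace ℝ (Fin n) × ℝ))))ᗮ ↔ ∀ e ∈ T, inner ℝ e.1 u = 0 := by
    intro u
    rw [mem_span_orthogonal_iff]
    simp only [Set.forall_mem_image, Finset.mem_coe]
  set U := (Submodule.span ℝ (Prod.fst '' (T : Set (EuclideanSpace ℝ (Fin n) × ℝ))))ᗮ
  have hT : ∀ u ∈ U, ∀ ε : ℝ, ∀ e ∈ T, lorentz e (z + ε • u, 1) = 0 := by
    intro u hu ε e he
    rw [mk_add_smul_one, lorentz_add_right, lorentz_smul_right, lorentz_mk_zero, hzT e he,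
      (hmem u).1 hu e he, mul_zero, add_zero]
  have hN : ∀ u, ∃ ε : ℝ, 0 < ε ∧ ∀ f ∈ N, lorentz f (z + ε • u, 1) ≤ 0 := by
    intro u
    obtain ⟨ε, hε, h⟩ := exists_pos_add_smul_nonpos N (fun e => lorentzForm n e) (z, 1) (u, 0)
      fun f hf => Or.inl (hzN f hf)
    refine ⟨ε, hε, fun f hf => ?_⟩
    rw [mk_add_smul_one]
    exact h f hf
  -- A positive-dimensional face extends from `z` both ways inside the closed ball, so strict
  -- convexity makes `z` non-ideal. A zero-dimensional face could be an ideal vertex, hence the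
  -- hypothesis `hU`.
  have hz1 : ‖z‖ < 1 := by
    obtain ⟨u, hu, hu0⟩ := Submodule.exists_mem_ne_zero_of_ne_bot hU
    obtain ⟨ε, hε, h1⟩ := hN u
    obtain ⟨δ, hδ, h2⟩ := hN (-u)
    exact norm_lt_one_of_add_smul hu0 hε hδ (hnorm _ (hT u hu ε) h1)
      (hnorm _ (hT (-u) (U.neg_mem hu) δ) h2)
  have hzA : z ∈ A := (hA z).2 ⟨hz1, hzT, fun f hf => (hzN f hf).le⟩
  refine ⟨hzA, vectorSpan_eq_of_forall_exists_add_smul_mem hzA ?_ ?_⟩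
  · intro x hx
    rw [hmem]
    intro e he
    have h1 := ((hA x).1 hx).2.1 e he
    have h2 := hzT e he
    rw [lorentz_mk_one] at h1 h2
    rw [inner_sub_right]
    linarith
  · intro u hu
    obtain ⟨ε, hε, h1⟩ := hN u
    -- Halving makes the new point the midpoint of `z` and a point of the closed ball, so it lies in
    -- the open ball.
    refine ⟨ε / 2, by positivity, ?_⟩
    have heq : z + (ε / 2) • u = (1 / 2 : ℝ) • z + (1 / 2 : ℝ) • (z + ε • u) := by module
    refine (hA _).2 ⟨?_, hT u hu _, ?_⟩
    · rw [heq]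
      refine (norm_add_le _ _).trans_lt ?_
      rw [norm_smul, norm_smul, Real.norm_of_nonneg (by norm_num)]
      linarith [hnorm _ (hT u hu ε) h1]
    · rw [heq]
      exact convex_lorentz_nonpos N (fun f hf => (hzN f hf).le) h1 (by norm_num) (by norm_num)
        (by norm_num)

namespace IsFacetSystem

variable {n : ℕ} {M : Finset (EuclideanSpace ℝ (Fin n) × ℝ)} {Q : Set (EuclideanSpace ℝ (Fin n))}

theorem convex (hM : IsFacetSystem M Q) : Convex ℝ Q := by
  have : Q = {x | ∀ e ∈ M, lorentz e (x, 1) ≤ 0} := Set.ext hM.mem_iff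
  rw [this]
  exact convex_lorentz_nonpos M

theorem snd_pos (hM : IsFacetSystem M Q) (hn : 1 ≤ n) {v : EuclideanSpace ℝ (Fin n) × ℝ}
    (hv0 : v ≠ 0) (hv : ∀ f ∈ M, lorentz f v ≤ 0) : 0 < v.2 := by
  obtain ⟨p, hp⟩ := hM.exists_interior
  have : Nontrivial (EuclideanSpace ℝ (Fin n)) :=
    Module.nontrivial_of_finrank_pos (R := ℝ) (by rw [finrank_euclideanSpace_fin]; omega)
  obtain ⟨u, hu⟩ := exists_ne (0 : EuclideanSpace ℝ (Fin n))
  exact snd_pos_of_forall_lorentz_nonpos ⊤ M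
    (fun x _ hx => hM.norm_le x ((hM.mem_iff x).2 hx)) Submodule.mem_top hp
    ⟨u, hu, Submodule.mem_top⟩ Submodule.mem_top hv0 hv

/-- A nonzero vector of the cone over `Q` is a positive multiple of a point of `Q`. -/
theorem exists_eq_smul (hM : IsFacetSystem M Q) (hn : 1 ≤ n) {v : EuclideanSpace ℝ (Fin n) × ℝ}
    (hv0 : v ≠ 0) (hv : ∀ f ∈ M, lorentz f v ≤ 0) : 0 < v.2 ∧ ∃ x ∈ Q, v = v.2 • (x, (1 : ℝ)) := by
  have hpos := hM.snd_pos hn hv0 hv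
  have heq : v = v.2 • (v.2⁻¹ • v.1, (1 : ℝ)) := by
    ext
    · simp [smul_smul, mul_inv_cancel₀ hpos.ne']
    · simp
  refine ⟨hpos, v.2⁻¹ • v.1, (hM.mem_iff _).2 fun f hf => ?_, heq⟩
  have := hv f hf
  rw [heq, lorentz_smul_right] at this
  exact nonpos_of_mul_nonpos_right this hpos

theorem lorentz_nonpos_of_forall_mem (hM : IsFacetSystem M Q) (hn : 1 ≤ n)
    {g : EuclideanSpace ℝ (Fin n) × ℝ} (hg : ∀ x ∈ Q, lorentz g (x, 1) ≤ 0)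
    {v : EuclideanSpace ℝ (Fin n) × ℝ} (hv : ∀ f ∈ M, lorentz f v ≤ 0) : lorentz g v ≤ 0 := by
  by_cases hv0 : v = 0
  · rw [hv0, ← lorentzForm_apply, map_zero]
  · obtain ⟨hpos, x, hx, heq⟩ := hM.exists_eq_smul hn hv0 hv
    rw [heq, lorentz_smul_right]
    exact mul_nonpos_of_nonneg_of_nonpos hpos.le (hg x hx)

variable {P : Set (EuclideanSpace ℝ (Fin n))}

theorem mem_inter_hypHyperplane (hP : P = Q ∩ hypSpace n) (e : EuclideanSpace ℝ (Fin n) × ℝ)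
    (x : EuclideanSpace ℝ (Fin n)) :
    x ∈ P ∩ hypHyperplane e ↔ x ∈ Q ∧ ‖x‖ < 1 ∧ lorentz e (x, 1) = 0 := by
  rw [hP, lorentz_mk_one, sub_eq_zero]
  simp only [Set.mem_inter_iff, hypHyperplane, hypSpace, Metric.mem_ball, dist_zero_right,
    Set.mem_ofPred_eq]
  tauto

theorem finrank_span_fst_singleton {e : EuclideanSpace ℝ (Fin n) × ℝ} (he : e.1 ≠ 0) :
    Module.finrank ℝ (Submodule.span ℝ {e.1})ᗮ + 1 = n := by
  have h := Submodule.finrank_add_finrank_orthogonal (Submodule.span ℝ {e.1})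
  rw [finrank_span_singleton he, finrank_euclideanSpace_fin] at h
  omega

theorem fst_ne_zero (hM : IsFacetSystem M Q) {e : EuclideanSpace ℝ (Fin n) × ℝ} (he : e ∈ M) :
    e.1 ≠ 0 :=
  fst_ne_zero_of_lorentz_pos (by rw [hM.lorentz_self e he]; exact one_pos)

/-- The witness point of irredundance is a relative interior point of the facet. For `n = 1` the
facet is a single point, which may be ideal and thus absent from `P`. -/
theorem facet_point_mem (hM : IsFacetSystem M Q) (hP : P = Q ∩ hypSpace n) (hn : 2 ≤ n)
    {e : EuclideanSpace ℝ (Fin n) × ℝ} (he : e ∈ M) {z : EuclideanSpace ℝ (Fin n)}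
    (hz : lorentz e (z, 1) = 0) (hz' : ∀ f ∈ M, f ≠ e → lorentz f (z, 1) < 0) :
    z ∈ P ∩ hypHyperplane e ∧
      vectorSpan ℝ (P ∩ hypHyperplane e) = (Submodule.span ℝ {e.1})ᗮ := by
  classical
  have hmem : ∀ x, lorentz e (x, 1) = 0 →
      (x ∈ Q ↔ ∀ f ∈ M.erase e, lorentz f (x, 1) ≤ 0) := by
    intro x hx
    rw [hM.mem_iff]
    refine ⟨fun h f hf => h f (Finset.mem_of_mem_erase hf), fun h f hf => ?_⟩
    by_cases hfe : f = e
    · rw [hfe, hx]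
    · exact h f (Finset.mem_erase.2 ⟨hfe, hf⟩)
  have h := vectorSpan_eq_span_orthogonal (A := P ∩ hypHyperplane e) (T := {e}) (N := M.erase e)
    (z := z) ?_ ?_ (by simpa using hz) ?_ ?_
  · simpa only [Finset.coe_singleton, Set.image_singleton] using h
  · intro x
    rw [mem_inter_hypHyperplane hP]
    simp only [Finset.mem_singleton, forall_eq]
    constructor
    · rintro ⟨h1, h2, h3⟩
      exact ⟨h2, h3, (hmem x h3).1 h1⟩
    · rintro ⟨h2, h3, h1⟩
      exact ⟨(hmem x h3).2 h1, h2, h3⟩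
  · intro x hx1 hx2
    exact hM.norm_le x ((hmem x (hx1 e (Finset.mem_singleton_self e))).2 hx2)
  · exact fun f hf => hz' f (Finset.mem_of_mem_erase hf) (Finset.ne_of_mem_erase hf)
  · rw [Finset.coe_singleton, Set.image_singleton]
    intro hbot
    have := finrank_span_fst_singleton (hM.fst_ne_zero he)
    rw [hbot, finrank_bot] at this
    omega

theorem coe_subset_facetNormals (hM : IsFacetSystem M Q) (hP : P = Q ∩ hypSpace n) (hn : 2 ≤ n) :
    ↑M ⊆ facetNormals P := by
  intro e he
  obtain ⟨z, hz, hz'⟩ := hM.exists_facet_point e he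
  obtain ⟨h1, h2⟩ := hM.facet_point_mem hP hn he hz hz'
  refine ⟨hM.lorentz_self e he, ?_, ⟨z, h1⟩, ?_⟩
  · intro x hx
    rw [hP] at hx
    refine ⟨hx.2, ?_⟩
    have := (hM.mem_iff x).1 hx.1 e he
    rw [lorentz_mk_one] at this
    linarith
  · rw [affDim, h2]
    exact finrank_span_fst_singleton (hM.fst_ne_zero he)

/-- By Farkas, a facet normal `e` is a nonnegative combination of `M`. Any `f` with nonzero
coefficient vanishes on the facet of `e`, which spans a hyperplane, so `f` is proportional to `e`.
Unit length and the side of an interior point force `f = e`. -/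
theorem facetNormals_subset (hM : IsFacetSystem M Q) (hP : P = Q ∩ hypSpace n) (hn : 1 ≤ n)
    (hQ : Q ⊆ closure P) : facetNormals P ⊆ ↑M := by
  classical
  rintro e ⟨he1, he2, ⟨x, hx⟩, he4⟩
  have hle : ∀ y ∈ Q, lorentz e (y, 1) ≤ 0 := by
    have hclosed : IsClosed {y : EuclideanSpace ℝ (Fin n) | lorentz e (y, 1) ≤ 0} := by
      refine isClosed_le ?_ continuous_const
      simp only [lorentz_mk_one]
      fun_prop
    refine fun y hy => closure_minimal (fun y hy => ?_) hclosed (hQ hy)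
    rw [Set.mem_ofPred_eq, lorentz_mk_one]
    linarith [(he2 hy).2]
  obtain ⟨c, hc, hsum⟩ := exists_nonneg_sum_smul_of_forall_nonpos M (fun f => lorentzForm n f)
    (lorentzForm n e) fun v hv => hM.lorentz_nonpos_of_forall_mem hn hle hv
  have he0 : e.1 ≠ 0 := fst_ne_zero_of_lorentz_pos (by rw [he1]; exact one_pos)
  obtain ⟨f, hf, hcf⟩ : ∃ f ∈ M, c f ≠ 0 := by
    by_contra hall
    push Not at hall
    have h0 : lorentzForm n e = 0 := by
      rw [hsum]
      exact Finset.sum_eq_zero fun f hf => by rw [hall f hf, zero_smul]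
    have := lorentzForm_injective n (h0.trans (map_zero _).symm)
    exact he0 (by rw [this]; rfl)
  have hfz : ∀ y ∈ P ∩ hypHyperplane e, lorentz f (y, 1) = 0 := by
    intro y hy
    obtain ⟨hyQ, -, hy0⟩ := (mem_inter_hypHyperplane hP e y).1 hy
    have h1 := LinearMap.congr_fun hsum (y, 1)
    simp only [LinearMap.sum_apply, LinearMap.smul_apply, lorentzForm_apply, smul_eq_mul, hy0] at h1
    have h2 := (Finset.sum_eq_zero_iff_of_nonpos fun g hg =>
      mul_nonpos_of_nonneg_of_nonpos (hc g) ((hM.mem_iff y).1 hyQ g hg)).1 h1.symm f hf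
    exact (mul_eq_zero.1 h2).resolve_left hcf
  have hsub : ∀ g : EuclideanSpace ℝ (Fin n) × ℝ,
      (∀ y ∈ P ∩ hypHyperplane e, lorentz g (y, 1) = 0) →
      vectorSpan ℝ (P ∩ hypHyperplane e) ≤ (Submodule.span ℝ {g.1})ᗮ := by
    intro g hg
    rw [vectorSpan_eq_span_vsub_set_right ℝ hx, Submodule.span_le]
    rintro _ ⟨y, hy, rfl⟩
    have h1 := hg y hy
    have h2 := hg x hx
    rw [lorentz_mk_one] at h1 h2
    rw [SetLike.mem_coe, mem_span_orthogonal_iff]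
    rintro _ rfl
    show inner ℝ g.1 (y - x) = 0
    rw [inner_sub_right]
    linarith
  have heq := Submodule.eq_of_le_of_finrank_eq
    (hsub e fun y hy => ((mem_inter_hypHyperplane hP e y).1 hy).2.2) (by
      have := finrank_span_fst_singleton he0
      rw [affDim] at he4
      omega)
  have hle' := hsub f hfz
  rw [heq, Submodule.orthogonal_le_orthogonal_iff, Submodule.span_singleton_le_iff_mem,
    Submodule.mem_span_singleton] at hle'
  obtain ⟨t, ht⟩ := hle'
  have hft : f = t • e := by
    refine Prod.ext ht.symm ?_
    have h1 := hfz x hx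
    have h2 := ((mem_inter_hypHyperplane hP e x).1 hx).2.2
    rw [lorentz_mk_one] at h1 h2
    rw [← ht, real_inner_smul_left] at h1
    rw [Prod.smul_snd, smul_eq_mul]
    linear_combination t * h2 - h1
  have ht1 : t * t = 1 := by
    have := hM.lorentz_self f hf
    rwa [hft, lorentz_smul_left, lorentz_smul_right, he1, mul_one] at this
  obtain ⟨p, hp⟩ := hM.exists_interior
  have h1 := hp f hf
  have h2 := hle p ((hM.mem_iff p).2 fun g hg => (hp g hg).le)
  rw [hft, lorentz_smul_left] at h1
  rcases mul_self_eq_one_iff.1 ht1 with rfl | rfl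
  · rw [one_smul] at hft
    exact hft ▸ hf
  · linarith

theorem ncard_facets (hM : IsFacetSystem M Q) (hP : P = Q ∩ hypSpace n) (hn : 2 ≤ n)
    (hQ : Q ⊆ closure P) : (facets P).ncard = M.card := by
  have heq : facetNormals P = ↑M :=
    (hM.facetNormals_subset hP (by omega) hQ).antisymm (hM.coe_subset_facetNormals hP hn)
  rw [facets, heq, Set.InjOn.ncard_image, Set.ncard_coe_finset]
  intro e he f hf hef
  by_contra hne
  obtain ⟨z, hz, hz'⟩ := hM.exists_facet_point e he
  have h1 := (hM.facet_point_mem hP hn he hz hz').1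
  have hef : P ∩ hypHyperplane e = P ∩ hypHyperplane f := hef
  rw [hef, mem_inter_hypHyperplane hP] at h1
  exact (hz' f hf (Ne.symm hne)).ne h1.2.2

end IsFacetSystem

/-! ### Non-obtuse angles: signs of products and independence of normals. -/

/-- The Lorentzian form is positive definite on the orthogonal complement of a point of hyperbolic
space. -/
theorem eq_zero_of_lorentz_self_nonpos {n : ℕ} {u : EuclideanSpace ℝ (Fin n) × ℝ}
    {q : EuclideanSpace ℝ (Fin n)} (hq : ‖q‖ < 1) (hu : lorentz u (q, 1) = 0)
    (huu : lorentz u u ≤ 0) : u = 0 := by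
  rw [lorentz_mk_one, sub_eq_zero] at hu
  rw [lorentz, real_inner_self_eq_norm_sq] at huu
  have h1 : |u.2| ≤ ‖u.1‖ * ‖q‖ := hu ▸ abs_real_inner_le_norm _ _
  have h2 : ‖u.1‖ ≤ |u.2| := by
    rw [← abs_norm]
    exact sq_le_sq.1 (by nlinarith)
  have h3 : ‖u.1‖ = 0 := by
    by_contra h
    have : 0 < ‖u.1‖ := lt_of_le_of_ne (norm_nonneg _) (Ne.symm h)
    nlinarith
  rw [h3, zero_mul] at h1
  exact Prod.ext (norm_eq_zero.1 h3) (abs_nonpos_iff.1 h1)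

/-- Vectors with pairwise nonpositive products in a positive definite space which lie in a common
open half-space are linearly independent. -/
theorem linearIndepOn_of_lorentz_nonpos {n : ℕ} {T : Finset (EuclideanSpace ℝ (Fin n) × ℝ)}
    (hT : ∀ e ∈ T, ∀ f ∈ T, e ≠ f → lorentz e f ≤ 0) {q : EuclideanSpace ℝ (Fin n)} (hq : ‖q‖ < 1)
    (hTq : ∀ e ∈ T, lorentz e (q, 1) = 0) {p : EuclideanSpace ℝ (Fin n) × ℝ}
    (hp : ∀ e ∈ T, lorentz e p < 0) : LinearIndepOn ℝ id (T : Set (EuclideanSpace ℝ (Fin n) × ℝ)) := by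
  rw [linearIndepOn_finset_iff]
  intro c hc
  simp only [id] at hc
  have apply_sum : ∀ (d : EuclideanSpace ℝ (Fin n) × ℝ → ℝ) (v : EuclideanSpace ℝ (Fin n) × ℝ),
      lorentz (∑ e ∈ T, d e • e) v = ∑ e ∈ T, d e * lorentz e v := by
    intro d v
    rw [← lorentzForm_apply, map_sum, LinearMap.sum_apply]
    simp only [map_smul, LinearMap.smul_apply, lorentzForm_apply, smul_eq_mul]
  -- Separate the positive and negative coefficients of a relation. The common value has nonpositive
  -- square, since the two supports are disjoint and only products of distinct vectors survive.
  -- Definiteness makes it zero, and pairing with `p` kills every coefficient.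
  have hpm : ∑ e ∈ T, max (c e) 0 • e = ∑ e ∈ T, max (-c e) 0 • e := by
    rw [← sub_eq_zero, ← Finset.sum_sub_distrib, ← hc]
    refine Finset.sum_congr rfl fun e _ => ?_
    rw [← sub_smul]
    congr 1
    rcases le_total (c e) 0 with h | h
    · rw [max_eq_right h, max_eq_left (by linarith)]; ring
    · rw [max_eq_left h, max_eq_right (by linarith)]; ring
  have hzero : ∑ e ∈ T, max (c e) 0 • e = 0 := by
    refine eq_zero_of_lorentz_self_nonpos hq ?_ ?_
    · rw [apply_sum]
      exact Finset.sum_eq_zero fun e he => by rw [hTq e he, mul_zero]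
    · conv_lhs => arg 2; rw [hpm]
      rw [apply_sum]
      refine Finset.sum_nonpos fun e he => ?_
      rw [lorentz_comm, apply_sum, Finset.mul_sum]
      refine Finset.sum_nonpos fun f hf => ?_
      by_cases hfe : f = e
      · subst hfe
        rcases le_total (c f) 0 with h | h
        · rw [max_eq_right h, zero_mul]
        · rw [max_eq_right (by linarith : -c f ≤ 0), zero_mul, mul_zero]
      · exact mul_nonpos_of_nonneg_of_nonpos (le_max_right _ _)
          (mul_nonpos_of_nonneg_of_nonpos (le_max_right _ _) (hT f hf e he hfe))
  have key : ∀ d : EuclideanSpace ℝ (Fin n) × ℝ → ℝ, (∀ e, 0 ≤ d e) → ∑ e ∈ T, d e • e = 0 →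
      ∀ e ∈ T, d e = 0 := by
    intro d hd hsum e he
    have h1 := apply_sum d p
    rw [hsum, ← lorentzForm_apply, map_zero, LinearMap.zero_apply] at h1
    have h2 := (Finset.sum_eq_zero_iff_of_nonpos fun f hf =>
      mul_nonpos_of_nonneg_of_nonpos (hd f) (hp f hf).le).1 h1.symm e he
    exact (mul_eq_zero.1 h2).resolve_right (hp e he).ne
  intro e he
  have h1 := key (fun e => max (c e) 0) (fun _ => le_max_right _ _) hzero e he
  have h2 := key (fun e => max (-c e) 0) (fun _ => le_max_right _ _) (hpm ▸ hzero) e he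
  have h3 := le_max_left (c e) 0
  have h4 := le_max_left (-c e) 0
  linarith

/-- The vectors orthogonal to two distinct points form a space of codimension two. -/
theorem card_add_one_le_of_linearIndepOn {n : ℕ} {T : Finset (EuclideanSpace ℝ (Fin n) × ℝ)}
    (hT : LinearIndepOn ℝ id (T : Set (EuclideanSpace ℝ (Fin n) × ℝ)))
    {a b : EuclideanSpace ℝ (Fin n)} (hab : a ≠ b) (ha : ∀ e ∈ T, lorentz e (a, 1) = 0)
    (hb : ∀ e ∈ T, lorentz e (b, 1) = 0) : T.card + 1 ≤ n := by
  set φ : (EuclideanSpace ℝ (Fin n) × ℝ) →ₗ[ℝ] ℝ × ℝ :=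
    (lorentzForm n (a, 1)).prod (lorentzForm n (b, 1)) with hφ
  have hsurj : Function.Surjective φ := by
    rintro ⟨α, β⟩
    have hd : inner ℝ (a - b) (a - b) ≠ 0 := fun h => hab (sub_eq_zero.1 (inner_self_eq_zero.1 h))
    set u := ((α - β) / inner ℝ (a - b) (a - b)) • (a - b) with hu
    have h1 : inner ℝ (a - b) u = α - β := by
      rw [hu, real_inner_smul_right, div_mul_cancel₀ _ hd]
    rw [inner_sub_left] at h1
    refine ⟨(u, inner ℝ a u - α), Prod.ext ?_ ?_⟩
    · show lorentz (a, 1) (u, inner ℝ a u - α) = α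
      simp [lorentz]
    · show lorentz (b, 1) (u, inner ℝ a u - α) = β
      simp only [lorentz]
      linarith
  have h1 := LinearMap.finrank_range_add_finrank_ker φ
  rw [LinearMap.range_eq_top.2 hsurj, finrank_top, Module.finrank_prod, Module.finrank_prod,
    finrank_euclideanSpace_fin, Module.finrank_self] at h1
  have h2 : Submodule.span ℝ (T : Set (EuclideanSpace ℝ (Fin n) × ℝ)) ≤ LinearMap.ker φ := by
    rw [Submodule.span_le]
    intro e he
    rw [SetLike.mem_coe, LinearMap.mem_ker]
    refine Prod.ext ?_ ?_
    · show lorentz (a, 1) e = 0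
      rw [lorentz_comm, ha e he]
    · show lorentz (b, 1) e = 0
      rw [lorentz_comm, hb e he]
  have h3 := Submodule.finrank_mono h2
  have h4 : Module.finrank ℝ (Submodule.span ℝ (T : Set (EuclideanSpace ℝ (Fin n) × ℝ))) = T.card :=
    finrank_span_finset_eq_card hT
  omega

/-- The dihedral angles enter the proof only here, and only through `π / m ≤ π / 2`. -/
theorem IsCoxeterPolytope.lorentz_nonpos_of_adjacent {n : ℕ} {P : Set (EuclideanSpace ℝ (Fin n))}
    (hP : IsCoxeterPolytope P) {e f : EuclideanSpace ℝ (Fin n) × ℝ} (he : e ∈ facetNormals P)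
    (hf : f ∈ facetNormals P) (hef : e ≠ f) (hadj : FacetsAdjacent P e f) : lorentz e f ≤ 0 := by
  obtain ⟨m, hm, h⟩ := hP.dihedralAngle_eq e he f hf hef hadj
  have hm' : (2 : ℝ) ≤ m := by exact_mod_cast hm
  have : dihedralAngle e f ≤ Real.pi / 2 := by
    rw [h]
    exact div_le_div_of_nonneg_left Real.pi_pos.le two_pos hm'
  rw [dihedralAngle, Real.arccos_le_pi_div_two] at this
  linarith

namespace IsFacetSystem

variable {n : ℕ} {M : Finset (EuclideanSpace ℝ (Fin n) × ℝ)} {Q P : Set (EuclideanSpace ℝ (Fin n))}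

/-- Two facets meeting in a point in the relative interior of a face of codimension two, as
witnessed by a subsystem `N` defining the first facet, are adjacent. -/
theorem facetsAdjacent (hM : IsFacetSystem M Q) (hP : P = Q ∩ hypSpace n) (hn : 3 ≤ n)
    {e f : EuclideanSpace ℝ (Fin n) × ℝ} (he : e ∈ M) {N : Finset (EuclideanSpace ℝ (Fin n) × ℝ)}
    (hN : ∀ x, lorentz e (x, 1) = 0 → (x ∈ Q ↔ ∀ f ∈ N, lorentz f (x, 1) ≤ 0))
    {z : EuclideanSpace ℝ (Fin n)} (hze : lorentz e (z, 1) = 0) (hzf : lorentz f (z, 1) < 0)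
    {w : EuclideanSpace ℝ (Fin n)} (hwe : lorentz e (w, 1) = 0) (hwf : lorentz f (w, 1) = 0)
    (hw : ∀ g ∈ N, g ≠ f → lorentz g (w, 1) < 0) : FacetsAdjacent P e f := by
  classical
  have hmem : ∀ x, x ∈ P ∩ hypHyperplane e ∩ hypHyperplane f ↔
      x ∈ Q ∧ ‖x‖ < 1 ∧ lorentz e (x, 1) = 0 ∧ lorentz f (x, 1) = 0 := by
    intro x
    have h1 := mem_inter_hypHyperplane hP e x
    have h2 := mem_inter_hypHyperplane hP f x
    rw [Set.mem_inter_iff] at h2 ⊢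
    have h3 : x ∈ P ∩ hypHyperplane e → x ∈ P := fun h => h.1
    tauto
  have hmem' : ∀ x, lorentz e (x, 1) = 0 → lorentz f (x, 1) = 0 →
      (x ∈ Q ↔ ∀ g ∈ N.erase f, lorentz g (x, 1) ≤ 0) := by
    intro x hx1 hx2
    rw [hN x hx1]
    refine ⟨fun h g hg => h g (Finset.mem_of_mem_erase hg), fun h g hg => ?_⟩
    by_cases hgf : g = f
    · rw [hgf, hx2]
    · exact h g (Finset.mem_erase.2 ⟨hgf, hg⟩)
  have hfin : Module.finrank ℝ (Submodule.span ℝ {e.1, f.1})ᗮ + 2 = n := by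
    -- Along `z - w` the normal `e` is constant while `f` changes, so the Euclidean parts are
    -- independent.
    have hli : LinearIndependent ℝ ![e.1, f.1] := by
      rw [LinearIndependent.pair_iff]
      intro s t hst
      rw [lorentz_mk_one] at hze hzf hwe hwf
      have h1 : inner ℝ (s • e.1 + t • f.1) (z - w) = (0 : ℝ) := by rw [hst, inner_zero_left]
      rw [inner_add_left, real_inner_smul_left, real_inner_smul_left, inner_sub_right,
        inner_sub_right] at h1
      have h2 : t * (inner ℝ f.1 z - inner ℝ f.1 w) = 0 := by
        have : inner ℝ e.1 z - inner ℝ e.1 w = 0 := by linarith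
        rw [this, mul_zero, zero_add] at h1
        exact h1
      have ht : t = 0 := (mul_eq_zero.1 h2).resolve_right (by linarith)
      rw [ht, zero_smul, add_zero] at hst
      exact ⟨(smul_eq_zero.1 hst).resolve_right (hM.fst_ne_zero he), ht⟩
    have h1 := finrank_span_eq_card hli
    rw [Matrix.range_cons_cons_empty, Fintype.card_fin] at h1
    have h := Submodule.finrank_add_finrank_orthogonal (Submodule.span ℝ {e.1, f.1})
    rw [h1, finrank_euclideanSpace_fin] at h
    omega
  have himg : Prod.fst '' (({e, f} : Finset (EuclideanSpace ℝ (Fin n) × ℝ)) :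
      Set (EuclideanSpace ℝ (Fin n) × ℝ)) = {e.1, f.1} := by
    rw [Finset.coe_pair, Set.image_pair]
  have h := vectorSpan_eq_span_orthogonal (A := P ∩ hypHyperplane e ∩ hypHyperplane f)
    (T := {e, f}) (N := N.erase f) (z := w) ?_ ?_ ?_ ?_ ?_
  · refine ⟨⟨w, h.1⟩, ?_⟩
    rw [affDim, h.2, himg]
    exact hfin
  · intro x
    rw [hmem]
    simp only [Finset.mem_insert, Finset.mem_singleton, forall_eq_or_imp, forall_eq]
    constructor
    · rintro ⟨h1, h2, h3, h4⟩
      exact ⟨h2, ⟨h3, h4⟩, (hmem' x h3 h4).1 h1⟩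
    · rintro ⟨h2, ⟨h3, h4⟩, h1⟩
      exact ⟨(hmem' x h3 h4).2 h1, h2, h3, h4⟩
  · intro x hx1 hx2
    exact hM.norm_le x ((hmem' x (hx1 e (by simp)) (hx1 f (by simp))).2 hx2)
  · simp only [Finset.mem_insert, Finset.mem_singleton, forall_eq_or_imp, forall_eq]
    exact ⟨hwe, hwf⟩
  · exact fun g hg => hw g (Finset.mem_of_mem_erase hg) (Finset.ne_of_mem_erase hg)
  -- Here `n ≥ 3` gives the codimension-two face positive dimension, so its relative interior point
  -- is not ideal.
  · rw [himg]
    intro hbot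
    rw [hbot, finrank_bot] at hfin
    omega

/-- Distinct facet normals of a Coxeter polytope have nonpositive Lorentzian product. -/
theorem lorentz_nonpos (hM : IsFacetSystem M Q) (hP : P = Q ∩ hypSpace n) (hn : 3 ≤ n)
    (hcox : IsCoxeterPolytope P) {e g : EuclideanSpace ℝ (Fin n) × ℝ} (he : e ∈ M) (hg : g ∈ M)
    (heg : e ≠ g) : lorentz e g ≤ 0 := by
  classical
  have hsub := hM.coe_subset_facetNormals hP (by omega)
  obtain ⟨z, hz, hz'⟩ := hM.exists_facet_point e he
  have hU : Convex ℝ {v : EuclideanSpace ℝ (Fin n) × ℝ | v.2 = 1 ∧ lorentz e v = 0} := by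
    rintro v ⟨hv1, hv2⟩ w ⟨hw1, hw2⟩ a b _ _ hab
    refine ⟨by simp [hv1, hw1, hab], ?_⟩
    rw [lorentz_add_right, lorentz_smul_right, lorentz_smul_right, hv2, hw2]
    simp
  -- Irredundance inside the hyperplane of `e`: `N` consists of the normals cutting out the facets
  -- of that facet, and these are adjacent to `e`.
  obtain ⟨N, hNM, hN, hNw⟩ := exists_irredundant hU (M.erase e) (fun f => lorentzForm n f)
    (p := (z, 1)) ⟨rfl, hz⟩
    fun f hf => hz' f (Finset.mem_of_mem_erase hf) (Finset.ne_of_mem_erase hf)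
  have hNsub : N ⊆ M := hNM.trans (Finset.erase_subset _ _)
  have hNe : ∀ f ∈ N, f ≠ e := fun f hf => Finset.ne_of_mem_erase (hNM hf)
  have hNQ : ∀ x, lorentz e (x, 1) = 0 → (x ∈ Q ↔ ∀ f ∈ N, lorentz f (x, 1) ≤ 0) := by
    intro x hx
    rw [hM.mem_iff]
    refine ⟨fun h f hf => h f (hNsub hf), fun h f hf => ?_⟩
    by_cases hfe : f = e
    · rw [hfe, hx]
    · exact hN (x, 1) ⟨rfl, hx⟩ h f (Finset.mem_erase.2 ⟨hfe, hf⟩)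
  have hadj : ∀ f ∈ N, lorentz e f ≤ 0 := by
    intro f hf
    obtain ⟨w, ⟨hw1, hw2⟩, hw3, hw4⟩ := hNw f hf
    have hw : w = (w.1, 1) := Prod.ext rfl hw1
    rw [hw] at hw2 hw3 hw4
    exact hcox.lorentz_nonpos_of_adjacent (hsub he) (hsub (hNsub hf)) (hNe f hf).symm
      (hM.facetsAdjacent hP hn he hNQ hz (hz' f (hNsub hf) (hNe f hf)) hw2 hw3 hw4)
  have hcone : ∀ v, lorentz e v = 0 → (∀ f ∈ N, lorentz f v ≤ 0) → lorentz g v ≤ 0 := by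
    intro v hv1 hv2
    by_cases hv0 : v = 0
    · rw [hv0, ← lorentzForm_apply, map_zero]
    have hne : (Submodule.span ℝ {e.1})ᗮ ≠ ⊥ := by
      intro hbot
      have := finrank_span_fst_singleton (hM.fst_ne_zero he)
      rw [hbot, finrank_bot] at this
      omega
    obtain ⟨u, hu, hu0⟩ := Submodule.exists_mem_ne_zero_of_ne_bot hne
    rw [mem_span_orthogonal_iff] at hu
    have hpos := snd_pos_of_forall_lorentz_nonpos (LinearMap.ker (lorentzForm n e)) N
      (fun x hx1 hx2 => hM.norm_le x ((hNQ x hx1).2 hx2)) (p := z) hz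
      (fun f hf => hz' f (hNsub hf) (hNe f hf))
      ⟨u, hu0, by rw [LinearMap.mem_ker, lorentzForm_apply, lorentz_mk_zero]; exact hu _ rfl⟩
      (LinearMap.mem_ker.2 hv1) hv0 hv2
    have heq : v.2⁻¹ • v = (v.2⁻¹ • v.1, 1) := by
      ext <;> simp [inv_mul_cancel₀ hpos.ne']
    have h1 := hN (v.2⁻¹ • v) ⟨by rw [heq], by rw [lorentz_smul_right, hv1, mul_zero]⟩
      (fun f hf => by
        rw [lorentzForm_apply, lorentz_smul_right]
        exact mul_nonpos_of_nonneg_of_nonpos (inv_nonneg.2 hpos.le) (hv2 f hf))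
      g (Finset.mem_erase.2 ⟨heg.symm, hg⟩)
    rw [lorentzForm_apply, lorentz_smul_right] at h1
    exact nonpos_of_mul_nonpos_right h1 (inv_pos.2 hpos)
  -- On the orthogonal complement of `e`, the inequality of `g` follows from those of `N`. Composing
  -- with the projection along `e` applies Farkas on the whole space and gives `g = ∑ c f • f + t •
  -- e` with `c ≥ 0`.
  obtain ⟨c, hc, hsum⟩ := exists_nonneg_sum_smul_of_forall_nonpos N
    (fun f => lorentzForm n f - lorentz e f • lorentzForm n e)
    (lorentzForm n g - lorentz e g • lorentzForm n e) (by
      intro v hv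
      have hproj : ∀ f, (lorentzForm n f - lorentz e f • lorentzForm n e) v =
          lorentz f (v - lorentz e v • e) := by
        intro f
        rw [← lorentzForm_apply f, map_sub, map_smul]
        simp only [LinearMap.sub_apply, LinearMap.smul_apply, lorentzForm_apply, smul_eq_mul]
        rw [lorentz_comm f e, mul_comm]
      rw [hproj]
      refine hcone _ ?_ fun f hf => hproj f ▸ hv f hf
      rw [← lorentzForm_apply, map_sub, map_smul, lorentzForm_apply, lorentzForm_apply,
        hM.lorentz_self e he, smul_eq_mul, mul_one, sub_self])
  set t := lorentz e g - ∑ f ∈ N, c f * lorentz e f with ht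
  have hgv : ∀ v, lorentz g v = ∑ f ∈ N, c f * lorentz f v + t * lorentz e v := by
    intro v
    have h := LinearMap.congr_fun hsum v
    simp only [LinearMap.sum_apply, LinearMap.sub_apply, LinearMap.smul_apply, lorentzForm_apply,
      smul_eq_mul, mul_sub, Finset.sum_sub_distrib] at h
    rw [ht, sub_mul, Finset.sum_mul]
    simp only [mul_assoc]
    linarith
  -- If `t ≤ 0`, pair the expansion of `g` with `e`. If `t > 0` and `g ∉ N`, evaluating it at a
  -- relative interior point of the facet of `g` gives `0` as a negative number.
  by_cases ht0 : t ≤ 0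
  · have h := Finset.sum_nonpos fun f hf => mul_nonpos_of_nonneg_of_nonpos (hc f) (hadj f hf)
    linarith
  · by_cases hgN : g ∈ N
    · exact hadj g hgN
    exfalso
    obtain ⟨y, hy, hy'⟩ := hM.exists_facet_point g hg
    have h1 := hgv (y, 1)
    have h2 : ∑ f ∈ N, c f * lorentz f (y, 1) ≤ 0 := Finset.sum_nonpos fun f hf =>
      mul_nonpos_of_nonneg_of_nonpos (hc f) (hy' f (hNsub hf) (ne_of_mem_of_not_mem hf hgN)).le
    have h3 := mul_neg_of_pos_of_neg (not_le.1 ht0) (hy' e he heg)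
    linarith

/-- At most `n - 1` facets of a Coxeter polytope contain two given points. -/
theorem card_add_one_le (hM : IsFacetSystem M Q) (hP : P = Q ∩ hypSpace n) (hn : 3 ≤ n)
    (hcox : IsCoxeterPolytope P) {a b : EuclideanSpace ℝ (Fin n)} (ha : a ∈ Q) (hb : b ∈ Q)
    (hab : a ≠ b) {T : Finset (EuclideanSpace ℝ (Fin n) × ℝ)} (hT : T ⊆ M)
    (haT : ∀ e ∈ T, lorentz e (a, 1) = 0) (hbT : ∀ e ∈ T, lorentz e (b, 1) = 0) :
    T.card + 1 ≤ n := by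
  obtain ⟨p, hp⟩ := hM.exists_interior
  -- Even if `a` and `b` are both ideal, their midpoint is a hyperbolic point, by strict convexity
  -- of the ball.
  have hq : ‖(1 / 2 : ℝ) • a + (1 / 2 : ℝ) • b‖ < 1 :=
    norm_combo_lt_of_ne (hM.norm_le a ha) (hM.norm_le b hb) hab (by norm_num) (by norm_num)
      (by norm_num)
  refine card_add_one_le_of_linearIndepOn (linearIndepOn_of_lorentz_nonpos
    (fun e he f hf hef => hM.lorentz_nonpos hP hn hcox (hT he) (hT hf) hef) hq ?_
    fun e he => hp e (hT he)) hab haT hbT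
  intro e he
  have h1 := haT e he
  have h2 := hbT e he
  rw [lorentz_mk_one] at h1 h2 ⊢
  rw [inner_add_right, real_inner_smul_right, real_inner_smul_right]
  linarith

end IsFacetSystem

/-! ### Face lattices as lattices of supports. -/

/-- Nonnegative affine coordinates `x ↦ L i x + d i` on a polytope `A`, whose nonnegativity cuts
out `A` in its affine hull. -/
structure IsFaceCoord {V ι : Type*} [AddCommGroup V] [Module ℝ V] [TopologicalSpace V] (A : Set V)
    (L : ι → StrongDual ℝ V) (d : ι → ℝ) : Prop where
  convex : Convex ℝ A
  nonneg : ∀ x ∈ A, ∀ i, 0 ≤ L i x + d i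
  extend : ∀ x ∈ A, ∀ y ∈ A, ∀ ε : ℝ, (∀ i, 0 ≤ L i (x + ε • (x - y)) + d i) →
    x + ε • (x - y) ∈ A
  exists_pos : ∀ x ∈ A, ∃ i, 0 < L i x + d i

/-- `T` is empty or the set of nonvanishing coordinates of a point of `A`. -/
def IsFaceSupport {V ι : Type*} [AddCommGroup V] [Module ℝ V] [TopologicalSpace V] (A : Set V)
    (L : ι → StrongDual ℝ V) (d : ι → ℝ) (T : Set ι) : Prop :=
  T = ∅ ∨ ∃ x ∈ A, ∀ i, i ∈ T ↔ 0 < L i x + d i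

section FaceLattice

variable {V ι : Type*} [AddCommGroup V] [Module ℝ V] [TopologicalSpace V] {A : Set V}
  {L : ι → StrongDual ℝ V} {d : ι → ℝ}

/-- The face of `A` on which all coordinates outside `T` vanish. -/
def coordFace (A : Set V) (L : ι → StrongDual ℝ V) (d : ι → ℝ) (T : Set ι) : Set V :=
  {x ∈ A | ∀ i, i ∉ T → L i x + d i = 0}

/-- Beyond `x`, coordinates positive at `x` stay positive for a while, and those vanishing at `x`
also vanish at `y`, hence on the whole line. -/
theorem IsFaceCoord.exists_pos_extend [Finite ι] (h : IsFaceCoord A L d) {x y : V} (hx : x ∈ A)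
    (hy : y ∈ A) (hxy : ∀ i, L i x + d i = 0 → L i y + d i = 0) :
    ∃ ε : ℝ, 0 < ε ∧ x + ε • (x - y) ∈ A := by
  have key : ∀ᶠ ε : ℝ in nhdsWithin 0 (Set.Ioi 0), ∀ i, 0 ≤ L i (x + ε • (x - y)) + d i := by
    rw [Filter.eventually_all]
    intro i
    simp only [map_add, map_smul, map_sub, smul_eq_mul]
    rcases (h.nonneg x hx i).eq_or_lt with h0 | h0
    · have h1 := hxy i h0.symm
      have h2 : L i x - L i y = 0 := by linarith
      exact Filter.Eventually.of_forall fun ε => by rw [h2, mul_zero, add_zero, ← h0]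
    · have hc : Filter.Tendsto (fun ε : ℝ => L i x + ε * (L i x - L i y) + d i) (nhds 0)
          (nhds (L i x + 0 * (L i x - L i y) + d i)) := by
        apply Continuous.tendsto
        fun_prop
      rw [zero_mul, add_zero] at hc
      filter_upwards [nhdsWithin_le_nhds (hc.eventually (lt_mem_nhds h0))] with ε hε using hε.le
  obtain ⟨ε, h1, h2⟩ := (key.and self_mem_nhdsWithin).exists
  exact ⟨ε, h2, h.extend x hx y hy ε h1⟩

/-- The exposing functional is minus the sum of the coordinates outside `T`: a sum of nonnegative
terms is minimal, namely zero, exactly when all of them vanish. -/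
theorem IsFaceCoord.isExposed_coordFace [Fintype ι] (h : IsFaceCoord A L d) (T : Set ι) :
    IsExposed ℝ A (coordFace A L d T) := by
  classical
  rintro ⟨x₀, hx₀, hx₀'⟩
  have happly : ∀ x, (-∑ i ∈ Finset.univ.filter (· ∉ T), L i) x =
      ∑ i ∈ Finset.univ.filter (· ∉ T), d i -
        ∑ i ∈ Finset.univ.filter (· ∉ T), (L i x + d i) := by
    intro x
    rw [neg_apply, sum_apply, Finset.sum_add_distrib]
    ring
  have hzero : ∀ x, (∀ i, i ∉ T → L i x + d i = 0) →
      ∑ i ∈ Finset.univ.filter (· ∉ T), (L i x + d i) = 0 := fun x hx =>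
    Finset.sum_eq_zero fun i hi => hx i (Finset.mem_filter.1 hi).2
  have hnn : ∀ x ∈ A, 0 ≤ ∑ i ∈ Finset.univ.filter (· ∉ T), (L i x + d i) := fun x hx =>
    Finset.sum_nonneg fun i _ => h.nonneg x hx i
  refine ⟨-∑ i ∈ Finset.univ.filter (· ∉ T), L i, Set.ext fun x => ⟨?_, ?_⟩⟩
  · rintro ⟨hx, hx'⟩
    refine ⟨hx, fun y hy => ?_⟩
    rw [happly, happly, hzero x hx']
    linarith [hnn y hy]
  · rintro ⟨hx, hx'⟩
    refine ⟨hx, fun i hi => ?_⟩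
    have h1 := hx' x₀ hx₀
    rw [happly, happly, hzero x₀ hx₀'] at h1
    have h2 : ∑ i ∈ Finset.univ.filter (· ∉ T), (L i x + d i) = 0 :=
      le_antisymm (by linarith) (hnn x hx)
    exact (Finset.sum_eq_zero_iff_of_nonneg fun i _ => h.nonneg x hx i).1 h2 i
      (Finset.mem_filter.2 ⟨Finset.mem_univ i, hi⟩)

/-- Take `x₀` in the face with maximal support. Midpoints show that every point of the face has its
support inside that of `x₀`. Conversely, a point `y` of `A` with support inside that of `x₀` lies on
a segment of `A` continuing beyond `x₀`, so a functional maximal at `x₀` is also maximal at `y`. -/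
theorem IsFaceCoord.exists_coordFace_eq [Finite ι] (h : IsFaceCoord A L d) {F : Set V}
    (hF : IsExposed ℝ A F) : ∃ T, IsFaceSupport A L d T ∧ coordFace A L d T = F := by
  rcases F.eq_empty_or_nonempty with rfl | hne
  · refine ⟨∅, Or.inl rfl, Set.eq_empty_of_forall_notMem ?_⟩
    rintro x ⟨hx, hx'⟩
    obtain ⟨i, hi⟩ := h.exists_pos x hx
    exact hi.ne' (hx' i (Set.notMem_empty i))
  · have hFc := hF.convex h.convex
    have hFA : F ⊆ A := hF.subset
    obtain ⟨_, ⟨⟨x₀, hx₀, rfl⟩, hmax⟩⟩ := (Set.toFinite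
      ((fun x => {i | 0 < L i x + d i}) '' F)).exists_maximal (hne.image _)
    have hsupp : ∀ y ∈ F, ∀ i, 0 < L i y + d i → 0 < L i x₀ + d i := by
      intro y hy i hi
      have hval : ∀ j, L j ((1 / 2 : ℝ) • x₀ + (1 / 2 : ℝ) • y) + d j =
          (1 / 2) * (L j x₀ + d j) + (1 / 2) * (L j y + d j) := by
        intro j
        simp only [map_add, map_smul, smul_eq_mul]
        ring
      have hle := hmax (Set.mem_image_of_mem _
        (hFc hx₀ hy (by norm_num : (0 : ℝ) ≤ 1 / 2) (by norm_num : (0 : ℝ) ≤ 1 / 2)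
          (by norm_num))) (by
        intro j hj
        rw [Set.mem_ofPred_eq, hval]
        have h1 : 0 < L j x₀ + d j := hj
        linarith [h.nonneg y (hFA hy) j])
      refine hle (show 0 < L i _ + d i from ?_)
      rw [hval]
      linarith [h.nonneg x₀ (hFA hx₀) i]
    refine ⟨{i | 0 < L i x₀ + d i}, Or.inr ⟨x₀, hFA hx₀, fun i => Iff.rfl⟩, ?_⟩
    ext y
    constructor
    · rintro ⟨hy, hy'⟩
      obtain ⟨ε, hε, hmem⟩ := h.exists_pos_extend (hFA hx₀) hy fun i hi =>
        hy' i fun hi' => (ne_of_gt hi') hi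
      obtain ⟨l, hl⟩ := hF hne
      rw [hl] at hx₀ ⊢
      have h1 := hx₀.2 _ hmem
      rw [map_add, map_smul, map_sub, smul_eq_mul] at h1
      have h2 : l x₀ ≤ l y := by
        by_contra hlt
        nlinarith [mul_pos hε (sub_pos.2 (not_le.1 hlt))]
      exact ⟨hy, fun w hw => (hx₀.2 w hw).trans h2⟩
    · intro hy
      refine ⟨hFA hy, fun i hi => ?_⟩
      by_contra hne'
      exact hi (hsupp y hy i (lt_of_le_of_ne (h.nonneg y (hFA hy) i) (Ne.symm hne')))

/-- The face lattice of a polytope is the lattice of supports of its coordinates. -/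
theorem IsFaceCoord.nonempty_orderIso [Fintype ι] (h : IsFaceCoord A L d) :
    Nonempty ({T : Set ι // IsFaceSupport A L d T} ≃o {F : Set V // IsExposed ℝ A F}) := by
  refine ⟨RelIso.ofSurjective (OrderEmbedding.ofMapLEIff
    (fun T : {T : Set ι // IsFaceSupport A L d T} =>
      (⟨coordFace A L d T.1, h.isExposed_coordFace T.1⟩ : {F : Set V // IsExposed ℝ A F})) ?_) ?_⟩
  · rintro ⟨T, hT⟩ ⟨T', hT'⟩
    simp only [Subtype.mk_le_mk]
    constructor
    · intro hle i hi
      rcases hT with rfl | ⟨x, hx, hxT⟩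
      · exact absurd hi (Set.notMem_empty i)
      · by_contra hi'
        have hxF : x ∈ coordFace A L d T := ⟨hx, fun j hj =>
          le_antisymm (not_lt.1 fun hlt => hj ((hxT j).2 hlt)) (h.nonneg x hx j)⟩
        exact ((hxT i).1 hi).ne' ((hle hxF).2 i hi')
    · rintro hle x ⟨hx, hx'⟩
      exact ⟨hx, fun i hi => hx' i fun hi' => hi (hle hi')⟩
  · rintro ⟨F, hF⟩
    obtain ⟨T, hT, hTF⟩ := h.exists_coordFace_eq hF
    exact ⟨⟨T, hT⟩, Subtype.ext hTF⟩

end FaceLattice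

/-! ### Sign patterns and the two model polytopes. -/

/-- `T` contains a positive index if and only if it contains a negative one. -/
def SignBalanced {ι : Type*} (s : ι → SignType) (T : Set ι) : Prop :=
  (∃ i ∈ T, s i = 1) ↔ ∃ i ∈ T, s i = -1

theorem exists_equiv_of_card_fiber_eq {ι κ τ : Type*} [Fintype ι] [Fintype κ] [DecidableEq τ]
    (s : ι → τ) (t : κ → τ)
    (h : ∀ a, Fintype.card {i // s i = a} = Fintype.card {j // t j = a}) :
    ∃ σ : ι ≃ κ, ∀ i, t (σ i) = s i := by
  refine ⟨((Equiv.sigmaFiberEquiv s).symm.trans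
    (Equiv.sigmaCongrRight fun a => Fintype.equivOfCardEq (h a))).trans
    (Equiv.sigmaFiberEquiv t), fun i => ?_⟩
  exact (Fintype.equivOfCardEq (h (s i)) ⟨i, rfl⟩).2

/-- Polytopes whose supports are the balanced sets for sign functions with equally many positive,
negative and zero values are combinatorially equivalent. -/
theorem combEquiv_of_signBalanced {V W ι κ : Type*} [AddCommGroup V] [Module ℝ V]
    [TopologicalSpace V] [AddCommGroup W] [Module ℝ W] [TopologicalSpace W] [Fintype ι]
    [Fintype κ] {A : Set V} {B : Set W} {L : ι → StrongDual ℝ V} {d : ι → ℝ}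
    {L' : κ → StrongDual ℝ W} {d' : κ → ℝ} (hA : IsFaceCoord A L d) (hB : IsFaceCoord B L' d')
    {s : ι → SignType} {t : κ → SignType} (hs : ∀ T, IsFaceSupport A L d T ↔ SignBalanced s T)
    (ht : ∀ T, IsFaceSupport B L' d' T ↔ SignBalanced t T)
    (hcard : ∀ a, Fintype.card {i // s i = a} = Fintype.card {j // t j = a}) : CombEquiv A B := by
  obtain ⟨σ, hσ⟩ := exists_equiv_of_card_fiber_eq s t hcard
  obtain ⟨φ⟩ := hA.nonempty_orderIso
  obtain ⟨ψ⟩ := hB.nonempty_orderIso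
  have hiff : ∀ T, IsFaceSupport A L d T ↔ IsFaceSupport B L' d' (Equiv.Set.congr σ T) := by
    intro T
    rw [hs, ht, SignBalanced, SignBalanced]
    simp only [Equiv.Set.congr_apply, Set.exists_mem_image, hσ]
  let τ : {T : Set ι // IsFaceSupport A L d T} ≃o {T : Set κ // IsFaceSupport B L' d' T} :=
    { toEquiv := (Equiv.Set.congr σ).subtypeEquiv hiff
      map_rel_iff' := by
        rintro ⟨T, _⟩ ⟨T', _⟩
        exact Set.image_subset_image_iff σ.injective }
  exact ⟨(φ.symm.trans τ).trans ψ⟩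

theorem exists_mem_stdSimplex_forall_mem_iff {α : Type*} [Fintype α] (T : Set α) (hT : T.Nonempty) :
    ∃ y ∈ stdSimplex ℝ α, ∀ i, i ∈ T ↔ 0 < y i := by
  classical
  have hcard : 0 < (T.toFinset.card : ℝ) := by
    exact_mod_cast Finset.card_pos.2 (Set.toFinset_nonempty.2 hT)
  refine ⟨fun i => if i ∈ T then (T.toFinset.card : ℝ)⁻¹ else 0, ⟨fun i => ?_, ?_⟩, fun i => ?_⟩
  · dsimp only
    split_ifs <;> positivity
  · rw [← Finset.sum_filter, Finset.sum_const, nsmul_eq_mul]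
    have : Finset.univ.filter (· ∈ T) = T.toFinset := by ext; simp
    rw [this, mul_inv_cancel₀ hcard.ne']
  · dsimp only
    split_ifs with h
    · simpa [h] using hcard
    · simpa using h

section SimplexProduct

variable (k l : ℕ)

/-- The coordinates of a product of two simplices. -/
noncomputable def simplexProductCoord : Fin (k + 1) ⊕ Fin (l + 1) →
    StrongDual ℝ ((Fin (k + 1) → ℝ) × (Fin (l + 1) → ℝ)) :=
  Sum.elim (fun i => (ContinuousLinearMap.proj i).comp (ContinuousLinearMap.fst ℝ _ _))
    (fun j => (ContinuousLinearMap.proj j).comp (ContinuousLinearMap.snd ℝ _ _))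

/-- The sign function of a product of two simplices. -/
def simplexProductSign : Fin (k + 1) ⊕ Fin (l + 1) → SignType :=
  Sum.elim (fun _ => 1) (fun _ => -1)

theorem isFaceCoord_simplexProduct :
    IsFaceCoord (simplexProduct k l) (simplexProductCoord k l) 0 where
  convex := (convex_stdSimplex ℝ _).prod (convex_stdSimplex ℝ _)
  nonneg := by
    rintro ⟨y, z⟩ ⟨hy, hz⟩ (i | j)
    · simpa [simplexProductCoord] using hy.1 i
    · simpa [simplexProductCoord] using hz.1 j
  extend := by
    rintro ⟨y, z⟩ ⟨hy, hz⟩ ⟨y', z'⟩ ⟨hy', hz'⟩ ε h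
    refine ⟨⟨fun i => ?_, ?_⟩, ⟨fun j => ?_, ?_⟩⟩
    · simpa [simplexProductCoord] using h (Sum.inl i)
    · simp only [Prod.fst_add, Prod.smul_fst, Prod.fst_sub, Pi.add_apply, Pi.smul_apply,
        Pi.sub_apply, smul_eq_mul, Finset.sum_add_distrib, ← Finset.mul_sum,
        Finset.sum_sub_distrib, hy.2, hy'.2]
      ring
    · simpa [simplexProductCoord] using h (Sum.inr j)
    · simp only [Prod.snd_add, Prod.smul_snd, Prod.snd_sub, Pi.add_apply, Pi.smul_apply,
        Pi.sub_apply, smul_eq_mul, Finset.sum_add_distrib, ← Finset.mul_sum,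
        Finset.sum_sub_distrib, hz.2, hz'.2]
      ring
  exists_pos := by
    rintro ⟨y, z⟩ ⟨hy, hz⟩
    obtain ⟨i, -, hi⟩ := Finset.exists_lt_of_sum_lt (s := Finset.univ) (f := fun _ => (0 : ℝ))
      (g := y) (by rw [hy.2]; simp)
    exact ⟨Sum.inl i, by simpa [simplexProductCoord] using hi⟩

theorem exists_pos_of_sum_pos {α : Type*} [Fintype α] {y : α → ℝ} (h : 0 < ∑ i, y i) :
    ∃ i, 0 < y i := by
  obtain ⟨i, -, hi⟩ := Finset.exists_lt_of_sum_lt (s := Finset.univ) (f := fun _ => (0 : ℝ))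
    (g := y) (by simpa using h)
  exact ⟨i, hi⟩

/-- Both factors have coordinate sum `1`, so each contributes a positive coordinate; uniform weights
realise any choice of two nonempty supports. -/
theorem isFaceSupport_simplexProduct_iff (T : Set (Fin (k + 1) ⊕ Fin (l + 1))) :
    IsFaceSupport (simplexProduct k l) (simplexProductCoord k l) 0 T ↔
      SignBalanced (simplexProductSign k l) T := by
  have hbal : SignBalanced (simplexProductSign k l) T ↔
      ((∃ i, Sum.inl i ∈ T) ↔ ∃ j, Sum.inr j ∈ T) := by
    simp [SignBalanced, simplexProductSign]
  rw [hbal]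
  constructor
  · rintro (rfl | ⟨⟨y, z⟩, ⟨hy, hz⟩, h⟩)
    · simp
    · obtain ⟨i, hi⟩ := exists_pos_of_sum_pos (hy.2.symm ▸ one_pos)
      obtain ⟨j, hj⟩ := exists_pos_of_sum_pos (hz.2.symm ▸ one_pos)
      exact iff_of_true ⟨i, (h _).2 (by simpa [simplexProductCoord] using hi)⟩
        ⟨j, (h _).2 (by simpa [simplexProductCoord] using hj)⟩
  · intro h
    by_cases hT : ∃ i, Sum.inl i ∈ T
    · obtain ⟨y, hy, hyT⟩ := exists_mem_stdSimplex_forall_mem_iff (Sum.inl ⁻¹' T) hT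
      obtain ⟨z, hz, hzT⟩ := exists_mem_stdSimplex_forall_mem_iff (Sum.inr ⁻¹' T) (h.1 hT)
      refine Or.inr ⟨(y, z), ⟨hy, hz⟩, ?_⟩
      rintro (i | j)
      · simpa [simplexProductCoord] using hyT i
      · simpa [simplexProductCoord] using hzT j
    · refine Or.inl (Set.eq_empty_of_forall_notMem ?_)
      rintro (i | j) hi
      · exact hT ⟨i, hi⟩
      · exact hT (h.2 ⟨j, hi⟩)

/-- The slice at height `t` is the base scaled by `1 - t`. In this description `t` is one more facet
coordinate, taking no part in the relation `∑ y = ∑ z`. -/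
theorem mem_pyramidOver_simplexProduct_iff (y : Fin (k + 1) → ℝ) (z : Fin (l + 1) → ℝ) (t : ℝ) :
    ((y, z), t) ∈ pyramidOver (simplexProduct k l) ↔
      (∀ i, 0 ≤ y i) ∧ (∀ j, 0 ≤ z j) ∧ 0 ≤ t ∧ ∑ i, y i = 1 - t ∧ ∑ j, z j = 1 - t := by
  set R : Set (((Fin (k + 1) → ℝ) × (Fin (l + 1) → ℝ)) × ℝ) :=
    {w | (∀ i, 0 ≤ w.1.1 i) ∧ (∀ j, 0 ≤ w.1.2 j) ∧ 0 ≤ w.2 ∧ ∑ i, w.1.1 i = 1 - w.2 ∧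
      ∑ j, w.1.2 j = 1 - w.2} with hR
  suffices pyramidOver (simplexProduct k l) = R by rw [this]; exact Iff.rfl
  apply Set.Subset.antisymm
  · refine convexHull_min ?_ ?_
    · rintro w (rfl | ⟨⟨hy, hz⟩, hw⟩)
      · simp [hR]
      · have hw : w.2 = 0 := hw
        refine ⟨hy.1, hz.1, hw.ge, ?_, ?_⟩
        · rw [hy.2, hw, sub_zero]
        · rw [hz.2, hw, sub_zero]
    · rintro v ⟨h1, h2, h3, h4, h5⟩ w ⟨h1', h2', h3', h4', h5'⟩ a b ha hb hab
      refine ⟨fun i => ?_, fun j => ?_, ?_, ?_, ?_⟩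
      · exact add_nonneg (mul_nonneg ha (h1 i)) (mul_nonneg hb (h1' i))
      · exact add_nonneg (mul_nonneg ha (h2 j)) (mul_nonneg hb (h2' j))
      · exact add_nonneg (mul_nonneg ha h3) (mul_nonneg hb h3')
      · simp only [Prod.fst_add, Prod.smul_fst, Prod.snd_add, Prod.smul_snd, Pi.add_apply,
          Pi.smul_apply, smul_eq_mul, Finset.sum_add_distrib, ← Finset.mul_sum, h4, h4']
        linear_combination hab
      · simp only [Prod.fst_add, Prod.smul_fst, Prod.snd_add, Prod.smul_snd, Pi.add_apply,
          Pi.smul_apply, smul_eq_mul, Finset.sum_add_distrib, ← Finset.mul_sum, h5, h5']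
        linear_combination hab
  · rintro ⟨⟨y, z⟩, t⟩ ⟨h1, h2, h3, h4, h5⟩
    dsimp only at h1 h2 h3 h4 h5
    have ht : t ≤ 1 := by
      have := Finset.sum_nonneg fun i (_ : i ∈ Finset.univ) => h1 i
      linarith
    rcases ht.eq_or_lt with rfl | ht
    · rw [sub_self] at h4 h5
      have hy : y = 0 := funext fun i =>
        (Finset.sum_eq_zero_iff_of_nonneg fun i _ => h1 i).1 h4 i (Finset.mem_univ i)
      have hz : z = 0 := funext fun j =>
        (Finset.sum_eq_zero_iff_of_nonneg fun j _ => h2 j).1 h5 j (Finset.mem_univ j)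
      rw [hy, hz]
      exact subset_convexHull ℝ _ (Or.inl rfl)
    · have ht' : 0 < 1 - t := by linarith
      have heq : (((y, z), t) : ((Fin (k + 1) → ℝ) × (Fin (l + 1) → ℝ)) × ℝ) =
          (1 - t) • (((1 - t)⁻¹ • y, (1 - t)⁻¹ • z), (0 : ℝ)) + t • ((0, 0), (1 : ℝ)) := by
        refine Prod.ext (Prod.ext ?_ ?_) ?_ <;> simp [smul_smul, mul_inv_cancel₀ ht'.ne']
      rw [heq]
      have hbase : ((1 - t)⁻¹ • y, (1 - t)⁻¹ • z) ∈ simplexProduct k l := by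
        refine ⟨⟨fun i => ?_, ?_⟩, ⟨fun j => ?_, ?_⟩⟩
        · exact mul_nonneg (inv_nonneg.2 ht'.le) (h1 i)
        · simp only [Pi.smul_apply, smul_eq_mul, ← Finset.mul_sum, h4, inv_mul_cancel₀ ht'.ne']
        · exact mul_nonneg (inv_nonneg.2 ht'.le) (h2 j)
        · simp only [Pi.smul_apply, smul_eq_mul, ← Finset.mul_sum, h5, inv_mul_cancel₀ ht'.ne']
      have hconv : Convex ℝ (pyramidOver (simplexProduct k l)) := convex_convexHull ℝ _
      have h6 : (((1 - t)⁻¹ • y, (1 - t)⁻¹ • z), (0 : ℝ)) ∈ pyramidOver (simplexProduct k l) :=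
        subset_convexHull ℝ _ (Or.inr ⟨hbase, rfl⟩)
      have h7 : ((0, 0), (1 : ℝ)) ∈ pyramidOver (simplexProduct k l) :=
        subset_convexHull ℝ _ (Or.inl rfl)
      exact hconv h6 h7 ht'.le h3 (by ring)

/-- The coordinates of a pyramid over a product of two simplices. -/
noncomputable def pyramidCoord : (Fin (k + 1) ⊕ Fin (l + 1)) ⊕ Unit →
    StrongDual ℝ (((Fin (k + 1) → ℝ) × (Fin (l + 1) → ℝ)) × ℝ) :=
  Sum.elim (fun i => (simplexProductCoord k l i).comp (ContinuousLinearMap.fst ℝ _ _))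
    (fun _ => ContinuousLinearMap.snd ℝ _ _)

/-- The sign function of a pyramid over a product of two simplices. -/
def pyramidSign : (Fin (k + 1) ⊕ Fin (l + 1)) ⊕ Unit → SignType :=
  Sum.elim (simplexProductSign k l) (fun _ => 0)

theorem isFaceCoord_pyramidOver :
    IsFaceCoord (pyramidOver (simplexProduct k l)) (pyramidCoord k l) 0 where
  convex := convex_convexHull ℝ _
  nonneg := by
    rintro ⟨⟨y, z⟩, t⟩ h
    rw [mem_pyramidOver_simplexProduct_iff] at h
    rintro ((i | j) | -)
    · simpa [pyramidCoord, simplexProductCoord] using h.1 i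
    · simpa [pyramidCoord, simplexProductCoord] using h.2.1 j
    · simpa [pyramidCoord] using h.2.2.1
  extend := by
    rintro ⟨⟨y, z⟩, t⟩ h ⟨⟨y', z'⟩, t'⟩ h' ε hε
    rw [mem_pyramidOver_simplexProduct_iff] at h h'
    refine (mem_pyramidOver_simplexProduct_iff k l (y + ε • (y - y')) (z + ε • (z - z'))
      (t + ε • (t - t'))).2 ⟨fun i => ?_, fun j => ?_, ?_, ?_, ?_⟩
    · simpa [pyramidCoord, simplexProductCoord] using hε (Sum.inl (Sum.inl i))
    · simpa [pyramidCoord, simplexProductCoord] using hε (Sum.inl (Sum.inr j))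
    · simpa [pyramidCoord] using hε (Sum.inr ())
    · simp only [Pi.add_apply, Pi.smul_apply, Pi.sub_apply, smul_eq_mul, Finset.sum_add_distrib,
        ← Finset.mul_sum, Finset.sum_sub_distrib, h.2.2.2.1, h'.2.2.2.1]
      ring
    · simp only [Pi.add_apply, Pi.smul_apply, Pi.sub_apply, smul_eq_mul, Finset.sum_add_distrib,
        ← Finset.mul_sum, Finset.sum_sub_distrib, h.2.2.2.2, h'.2.2.2.2]
      ring
  exists_pos := by
    rintro ⟨⟨y, z⟩, t⟩ h
    rw [mem_pyramidOver_simplexProduct_iff] at h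
    rcases h.2.2.1.eq_or_lt with rfl | ht
    · obtain ⟨i, hi⟩ := exists_pos_of_sum_pos (y := y) (by rw [h.2.2.2.1]; norm_num)
      exact ⟨Sum.inl (Sum.inl i), by simpa [pyramidCoord, simplexProductCoord] using hi⟩
    · exact ⟨Sum.inr (), by simpa [pyramidCoord] using ht⟩

/-- The `y`- and `z`-sums both equal `1 - t`, so they are positive together. The height may vanish
or not independently, and its singleton support is the apex. -/
theorem isFaceSupport_pyramidOver_iff (T : Set ((Fin (k + 1) ⊕ Fin (l + 1)) ⊕ Unit)) :
    IsFaceSupport (pyramidOver (simplexProduct k l)) (pyramidCoord k l) 0 T ↔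
      SignBalanced (pyramidSign k l) T := by
  classical
  have hbal : SignBalanced (pyramidSign k l) T ↔
      ((∃ i, Sum.inl (Sum.inl i) ∈ T) ↔ ∃ j, Sum.inl (Sum.inr j) ∈ T) := by
    simp [SignBalanced, pyramidSign, simplexProductSign]
  rw [hbal]
  constructor
  · rintro (rfl | ⟨⟨⟨y, z⟩, t⟩, hw, h⟩)
    · simp
    · rw [mem_pyramidOver_simplexProduct_iff] at hw
      obtain ⟨h1, h2, h3, h4, h5⟩ := hw
      have hpos : ∀ {m : ℕ} {u : Fin m → ℝ}, (∀ i, 0 ≤ u i) → ((∃ i, 0 < u i) ↔ 0 < ∑ i, u i) :=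
        fun hu => ⟨fun ⟨i, hi⟩ => Finset.sum_pos' (fun i _ => hu i) ⟨i, Finset.mem_univ i, hi⟩,
          exists_pos_of_sum_pos⟩
      have hl : ∀ i, Sum.inl (Sum.inl i) ∈ T ↔ 0 < y i := fun i => by
        simpa [pyramidCoord, simplexProductCoord] using h (Sum.inl (Sum.inl i))
      have hr : ∀ j, Sum.inl (Sum.inr j) ∈ T ↔ 0 < z j := fun j => by
        simpa [pyramidCoord, simplexProductCoord] using h (Sum.inl (Sum.inr j))
      simp only [hl, hr]
      rw [hpos h1, hpos h2, h4, h5]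
  · intro h
    by_cases hT : ∃ i, Sum.inl (Sum.inl i) ∈ T
    · obtain ⟨y, hy, hyT⟩ := exists_mem_stdSimplex_forall_mem_iff
        ((fun i => Sum.inl (Sum.inl i)) ⁻¹' T) hT
      obtain ⟨z, hz, hzT⟩ := exists_mem_stdSimplex_forall_mem_iff
        ((fun j => Sum.inl (Sum.inr j)) ⁻¹' T) (h.1 hT)
      obtain ⟨t, ht0, ht1, htT⟩ : ∃ t : ℝ, 0 ≤ t ∧ t < 1 ∧ (Sum.inr () ∈ T ↔ 0 < t) := by
        by_cases hu : Sum.inr () ∈ T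
        · exact ⟨1 / 2, by norm_num, by norm_num, iff_of_true hu (by norm_num)⟩
        · exact ⟨0, le_rfl, one_pos, iff_of_false hu (lt_irrefl 0)⟩
      have ht' : 0 < 1 - t := by linarith
      refine Or.inr ⟨(((1 - t) • y, (1 - t) • z), t), ?_, ?_⟩
      · rw [mem_pyramidOver_simplexProduct_iff]
        refine ⟨fun i => mul_nonneg ht'.le (hy.1 i), fun j => mul_nonneg ht'.le (hz.1 j), ht0,
          ?_, ?_⟩
        · simp only [Pi.smul_apply, smul_eq_mul, ← Finset.mul_sum, hy.2, mul_one]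
        · simp only [Pi.smul_apply, smul_eq_mul, ← Finset.mul_sum, hz.2, mul_one]
      · rintro ((i | j) | -)
        · simpa [pyramidCoord, simplexProductCoord, mul_pos_iff_of_pos_left ht'] using hyT i
        · simpa [pyramidCoord, simplexProductCoord, mul_pos_iff_of_pos_left ht'] using hzT j
        · simpa [pyramidCoord] using htT
    · have hT' : ¬ ∃ j, Sum.inl (Sum.inr j) ∈ T := fun hj => hT (h.2 hj)
      by_cases hu : Sum.inr () ∈ T
      · refine Or.inr ⟨((0, 0), 1), ?_, ?_⟩
        · rw [mem_pyramidOver_simplexProduct_iff]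
          simp
        · rintro ((i | j) | -)
          · simpa [pyramidCoord, simplexProductCoord] using fun hi => hT ⟨i, hi⟩
          · simpa [pyramidCoord, simplexProductCoord] using fun hi => hT' ⟨j, hi⟩
          · simpa [pyramidCoord] using hu
      · refine Or.inl (Set.eq_empty_of_forall_notMem ?_)
        rintro ((i | j) | u) hi
        · exact hT ⟨i, hi⟩
        · exact hT' ⟨j, hi⟩
        · exact hu hi

theorem card_simplexProductSign_fiber (a : SignType) :
    Fintype.card {i // simplexProductSign k l i = a} =
      if a = 1 then k + 1 else if a = -1 then l + 1 else 0 := by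
  rw [Fintype.card_congr Equiv.subtypeSum, Fintype.card_sum]
  cases a <;> simp [simplexProductSign]

theorem card_pyramidSign_fiber (a : SignType) :
    Fintype.card {i // pyramidSign k l i = a} =
      if a = 1 then k + 1 else if a = -1 then l + 1 else 1 := by
  rw [Fintype.card_congr Equiv.subtypeSum, Fintype.card_sum]
  have h := card_simplexProductSign_fiber k l a
  have h' : Fintype.card {i // pyramidSign k l (Sum.inl i) = a} =
      Fintype.card {i // simplexProductSign k l i = a} := Fintype.card_congr (Equiv.refl _)
  rw [h', h]
  cases a <;> simp [pyramidSign]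

end SimplexProduct

/-! ### The linear relation between `n + 2` normals. -/

/-- A linear relation with nonnegative-valued solutions supported exactly on a balanced set. -/
theorem exists_nonneg_of_signBalanced {ι : Type*} [Fintype ι] (c : ι → ℝ) {T : Set ι}
    (hT : SignBalanced (fun i => SignType.sign (c i)) T) :
    ∃ y : ι → ℝ, (∀ i ∈ T, 0 < y i) ∧ (∀ i, i ∉ T → y i = 0) ∧ ∑ i, c i * y i = 0 := by
  classical
  simp only [SignBalanced, sign_eq_one_iff, sign_eq_neg_one_iff] at hT
  by_cases hpos : ∃ i ∈ T, 0 < c i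
  · obtain ⟨i, hiT, hi⟩ := hpos
    obtain ⟨j, hjT, hj⟩ := hT.1 ⟨i, hiT, hi⟩
    -- With `a` and `b` the total positive and negative weights on `T`, giving `b` to the positive
    -- indices and `a` to the others makes the weighted sum `b * a - a * b`.
    set a := ∑ i, if i ∈ T then max (c i) 0 else 0 with ha
    set b := ∑ i, if i ∈ T then max (-c i) 0 else 0 with hb
    have hapos : 0 < a := Finset.sum_pos' (fun i _ => by split_ifs <;> simp)
      ⟨i, Finset.mem_univ i, by simp [hiT, hi]⟩
    have hbpos : 0 < b := Finset.sum_pos' (fun i _ => by split_ifs <;> simp)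
      ⟨j, Finset.mem_univ j, by simp [hjT, hj]⟩
    refine ⟨fun i => if i ∈ T then (if 0 < c i then b else a) else 0, fun i hi => ?_,
      fun i hi => by simp [hi], ?_⟩
    · simp only [hi, if_true]
      split_ifs <;> assumption
    · have h1 : ∀ i, c i * (if i ∈ T then (if 0 < c i then b else a) else 0) =
          b * (if i ∈ T then max (c i) 0 else 0) - a * (if i ∈ T then max (-c i) 0 else 0) := by
        intro i
        by_cases hi : i ∈ T
        · simp only [hi, if_true]
          split_ifs with hc
          · rw [max_eq_left hc.le, max_eq_right (by linarith)]; ring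
          · rw [max_eq_right (not_lt.1 hc), max_eq_left (by linarith)]; ring
        · simp [hi]
      simp only [h1, Finset.sum_sub_distrib, ← Finset.mul_sum]
      rw [← ha, ← hb]
      ring
  · have hneg : ¬ ∃ i ∈ T, c i < 0 := fun h => hpos (hT.2 h)
    push Not at hpos hneg
    refine ⟨fun i => if i ∈ T then 1 else 0, fun i hi => by simp [hi], fun i hi => by simp [hi],
      Finset.sum_eq_zero fun i _ => ?_⟩
    by_cases hi : i ∈ T
    · rw [le_antisymm (hpos i hi) (hneg i hi), zero_mul]
    · simp [hi]

/-- A vanishing sum with a positive term has a negative one; apply this to `c` and to `-c`. -/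
theorem signBalanced_setOf_pos {ι : Type*} [Fintype ι] {c y : ι → ℝ} (hy : ∀ i, 0 ≤ y i)
    (hsum : ∑ i, c i * y i = 0) : SignBalanced (fun i => SignType.sign (c i)) {i | 0 < y i} := by
  have key : ∀ b : ι → ℝ, ∑ i, b i * y i = 0 → (∃ i, 0 < y i ∧ 0 < b i) →
      ∃ i, 0 < y i ∧ b i < 0 := by
    rintro b hb ⟨i, hyi, hbi⟩
    by_contra hall
    push Not at hall
    have hnn : ∀ j, 0 ≤ b j * y j := by
      intro j
      rcases (hy j).eq_or_lt with h | h
      · rw [← h, mul_zero]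
      · exact mul_nonneg (hall j h) h.le
    exact (mul_pos hbi hyi).ne'
      ((Finset.sum_eq_zero_iff_of_nonneg fun j _ => hnn j).1 hb i (Finset.mem_univ i))
  simp only [SignBalanced, sign_eq_one_iff, sign_eq_neg_one_iff, Set.mem_ofPred_eq]
  refine ⟨key c hsum, fun ⟨i, hyi, hci⟩ => ?_⟩
  obtain ⟨j, hyj, hcj⟩ := key (fun i => -c i) (by simp [hsum]) ⟨i, hyi, by linarith⟩
  exact ⟨j, hyj, by linarith⟩

namespace IsFacetSystem

variable {n : ℕ} {M : Finset (EuclideanSpace ℝ (Fin n) × ℝ)} {Q P : Set (EuclideanSpace ℝ (Fin n))}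

/-- The linear part of the coordinate attached to a facet. -/
noncomputable def coord (M : Finset (EuclideanSpace ℝ (Fin n) × ℝ)) (e : M) :
    StrongDual ℝ (EuclideanSpace ℝ (Fin n)) :=
  -innerSL ℝ e.1.1

theorem coord_apply_add (e : M) (x : EuclideanSpace ℝ (Fin n)) :
    coord M e x + e.1.2 = -lorentz e.1 (x, 1) := by
  rw [lorentz_mk_one, coord, neg_apply, innerSL_apply_apply]
  ring

theorem nonempty (hM : IsFacetSystem M Q) (hn : 1 ≤ n) : M.Nonempty := by
  by_contra h
  rw [Finset.not_nonempty_iff_eq_empty] at h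
  have := hM.snd_pos hn (v := (0, -1)) (by simp) (by simp [h])
  norm_num at this

/-- If all facet hyperplanes passed through `x`, the vector from `x` to an interior point would be a
recession direction of the bounded set `Q`. -/
theorem exists_lorentz_ne_zero (hM : IsFacetSystem M Q) (hn : 1 ≤ n) (x : EuclideanSpace ℝ (Fin n)) :
    ∃ e ∈ M, lorentz e (x, 1) ≠ 0 := by
  by_contra! hall
  obtain ⟨p, hp⟩ := hM.exists_interior
  obtain ⟨e, he⟩ := hM.nonempty hn
  have heq : ((p - x, (0 : ℝ)) : EuclideanSpace ℝ (Fin n) × ℝ) = (p, 1) + (-1 : ℝ) • (x, 1) := by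
    ext <;> simp [sub_eq_add_neg]
  have hval : ∀ f ∈ M, lorentz f (p - x, 0) = lorentz f (p, 1) := by
    intro f hf
    rw [heq, lorentz_add_right, lorentz_smul_right, hall f hf, mul_zero, add_zero]
  refine lt_irrefl (0 : ℝ) (hM.snd_pos hn (v := (p - x, 0)) ?_ fun f hf => ?_)
  · intro h0
    have h1 := hval e he
    rw [h0, ← lorentzForm_apply, map_zero] at h1
    exact (hp e he).ne h1.symm
  · rw [hval f hf]
    exact (hp f hf).le

theorem isFaceCoord (hM : IsFacetSystem M Q) (hn : 1 ≤ n) :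
    IsFaceCoord Q (coord M) (fun e => e.1.2) where
  convex := hM.convex
  nonneg x hx e := by
    rw [coord_apply_add]
    linarith [(hM.mem_iff x).1 hx e.1 e.2]
  extend x _ y _ ε h := by
    refine (hM.mem_iff _).2 fun e he => ?_
    have := h ⟨e, he⟩
    rw [coord_apply_add] at this
    linarith
  exists_pos x hx := by
    obtain ⟨e, he, hne⟩ := hM.exists_lorentz_ne_zero hn x
    refine ⟨⟨e, he⟩, ?_⟩
    rw [coord_apply_add]
    linarith [lt_of_le_of_ne ((hM.mem_iff x).1 hx e he) hne]

/-- The normals of a polytope with `n + 2` facets satisfy exactly one linear relation. -/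
theorem exists_relation (hM : IsFacetSystem M Q) (hn : 1 ≤ n) (hcard : M.card = n + 2) :
    ∃ c : M → ℝ, (∃ e, c e ≠ 0) ∧ ∀ y : M → ℝ,
      ∑ e, c e * y e = 0 ↔ ∃ v, ∀ e : M, lorentz e.1 v = y e := by
  -- Evaluation against all normals is injective, because a kernel vector and its negative would
  -- both have positive height. Its image thus has dimension `n + 1` in a space of dimension `n +
  -- 2`, and `c` is the equation of this hyperplane.
  set H : (EuclideanSpace ℝ (Fin n) × ℝ) →ₗ[ℝ] (M → ℝ) :=
    LinearMap.pi fun e => lorentzForm n e.1 with hH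
  have hinj : LinearMap.ker H = ⊥ := by
    rw [LinearMap.ker_eq_bot']
    intro v hv
    have hz : ∀ f ∈ M, lorentz f v = 0 := fun f hf => congr_fun hv ⟨f, hf⟩
    by_contra hv0
    have h1 := hM.snd_pos hn hv0 fun f hf => (hz f hf).le
    have h2 := hM.snd_pos hn (neg_ne_zero.2 hv0) fun f hf => by
      rw [← lorentzForm_apply, map_neg, lorentzForm_apply, hz f hf, neg_zero]
    rw [Prod.snd_neg] at h2
    linarith
  have hrange : Module.finrank ℝ (LinearMap.range H) = n + 1 := by
    rw [LinearMap.finrank_range_of_inj (LinearMap.ker_eq_bot.1 hinj), Module.finrank_prod,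
      finrank_euclideanSpace_fin, Module.finrank_self]
  have htot : Module.finrank ℝ (M → ℝ) = n + 2 := by
    rw [Module.finrank_fintype_fun_eq_card, Fintype.card_coe, hcard]
  have hlt : LinearMap.range H < ⊤ := by
    rw [lt_top_iff_ne_top]
    intro htop
    rw [htop, finrank_top, htot] at hrange
    omega
  obtain ⟨φ, hφ0, hφ⟩ := Submodule.exists_le_ker_of_lt_top _ hlt
  have hker : LinearMap.range H = LinearMap.ker φ := by
    refine Submodule.eq_of_le_of_finrank_le hφ ?_
    have h1 := LinearMap.finrank_range_add_finrank_ker φ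
    have h2 : LinearMap.range φ ≠ ⊥ := by rwa [Ne, LinearMap.range_eq_bot]
    have h3 : 0 < Module.finrank ℝ (LinearMap.range φ) := by
      rw [Nat.pos_iff_ne_zero, Ne, Submodule.finrank_eq_zero]
      exact h2
    omega
  have happly : ∀ y, φ y = ∑ e, φ (Pi.single e 1) * y e := by
    intro y
    rw [LinearMap.pi_apply_eq_sum_univ φ y]
    refine Finset.sum_congr rfl fun e _ => ?_
    rw [smul_eq_mul, mul_comm]
    congr 2
    ext j
    simp [Pi.single_apply, eq_comm]
  refine ⟨fun e => φ (Pi.single e 1), ?_, fun y => ?_⟩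
  · by_contra! hall
    refine hφ0 (LinearMap.ext fun y => ?_)
    rw [happly]
    exact Finset.sum_eq_zero fun e _ => by rw [hall e, zero_mul]
  · rw [← happly, ← LinearMap.mem_ker, ← hker, LinearMap.mem_range]
    exact exists_congr fun v => ⟨fun h e => congr_fun h e, fun h => funext h⟩

/-- The nonnegative solutions of the relation are the coordinate vectors of the cone over `Q`, and a
nonzero cone vector rescales to height `1` without changing its support. -/
theorem isFaceSupport_iff (hM : IsFacetSystem M Q) (hn : 1 ≤ n) {c : M → ℝ}
    (hc : ∀ y : M → ℝ, ∑ e, c e * y e = 0 ↔ ∃ v, ∀ e : M, lorentz e.1 v = y e) (T : Set M) :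
    IsFaceSupport Q (coord M) (fun e => e.1.2) T ↔
      SignBalanced (fun e => SignType.sign (c e)) T := by
  constructor
  · rintro (rfl | ⟨x, hx, hT⟩)
    · simp [SignBalanced]
    · have h : ∑ e : M, c e * -lorentz e.1 (x, 1) = 0 := by
        have := (hc fun e => lorentz e.1 (x, 1)).2 ⟨(x, 1), fun e => rfl⟩
        simp only [mul_neg, Finset.sum_neg_distrib, this, neg_zero]
      have hTeq : T = {e : M | 0 < -lorentz e.1 (x, 1)} := by
        ext e
        rw [hT, coord_apply_add]
        exact Iff.rfl
      rw [hTeq]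
      exact signBalanced_setOf_pos (fun e => by linarith [(hM.mem_iff x).1 hx e.1 e.2]) h
  · intro hbal
    rcases T.eq_empty_or_nonempty with rfl | ⟨e₀, he₀⟩
    · exact Or.inl rfl
    · obtain ⟨y, hy1, hy2, hy3⟩ := exists_nonneg_of_signBalanced c hbal
      obtain ⟨v, hv⟩ := (hc fun e => -y e).1
        (by simp only [mul_neg, Finset.sum_neg_distrib, hy3, neg_zero])
      have hynn : ∀ e, 0 ≤ y e := fun e => by
        by_cases he : e ∈ T
        · exact (hy1 e he).le
        · exact (hy2 e he).ge
      have hv0 : v ≠ 0 := by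
        rintro rfl
        have := hv e₀
        rw [← lorentzForm_apply, map_zero] at this
        linarith [hy1 e₀ he₀]
      obtain ⟨hpos, x, hx, hvx⟩ := hM.exists_eq_smul hn hv0 fun f hf => by
        rw [hv ⟨f, hf⟩]
        linarith [hynn ⟨f, hf⟩]
      refine Or.inr ⟨x, hx, fun e => ?_⟩
      rw [coord_apply_add]
      have h := hv e
      rw [hvx, lorentz_smul_right] at h
      have h' : v.2 * -lorentz e.1 (x, 1) = y e := by linarith
      rw [← mul_pos_iff_of_pos_left hpos, h']
      refine ⟨hy1 e, fun hlt => ?_⟩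
      by_contra hne
      rw [hy2 e hne] at hlt
      exact lt_irrefl _ hlt

/-- Since no facet is redundant, at least two coefficients of a linear relation are positive. -/
theorem exists_two_pos (hM : IsFacetSystem M Q) {c : M → ℝ} (hc0 : ∃ e, c e ≠ 0)
    (hc : ∀ v, ∑ e : M, c e * lorentz e.1 v = 0) :
    2 ≤ Fintype.card {e : M // 0 < c e} := by
  obtain ⟨p, hp⟩ := hM.exists_interior
  have key : ∀ x : EuclideanSpace ℝ (Fin n), (∀ e : M, 0 ≤ c e * lorentz e.1 (x, 1)) →
      ∀ e, c e * lorentz e.1 (x, 1) = 0 := fun x hx e =>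
    (Finset.sum_eq_zero_iff_of_nonneg fun e _ => hx e).1 (hc (x, 1)) e (Finset.mem_univ e)
  have hex : ∃ e, 0 < c e := by
    by_contra! hall
    obtain ⟨e, he⟩ := hc0
    have := key p (fun f => mul_nonneg_of_nonpos_of_nonpos (hall f) (hp f.1 f.2).le) e
    exact he ((mul_eq_zero.1 this).resolve_right (hp e.1 e.2).ne)
  obtain ⟨e, he⟩ := hex
  -- If only `c e` were positive, then at a relative interior point of the facet of `e` all terms
  -- would be nonnegative with zero sum. This kills every other coefficient, and the relation fails
  -- at `p`.
  have hex' : ∃ f, f ≠ e ∧ 0 < c f := by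
    by_contra! hall
    obtain ⟨z, hz, hz'⟩ := hM.exists_facet_point e.1 e.2
    have hzero : ∀ f, f ≠ e → c f = 0 := by
      intro f hf
      have h := key z (fun g => by
        by_cases hg : g = e
        · rw [hg, hz, mul_zero]
        · exact mul_nonneg_of_nonpos_of_nonpos (hall g hg)
            (hz' g.1 g.2 fun h => hg (Subtype.ext h)).le) f
      exact (mul_eq_zero.1 h).resolve_right (hz' f.1 f.2 fun h => hf (Subtype.ext h)).ne
    have h := hc (p, 1)
    rw [Finset.sum_eq_single e (fun f _ hf => by rw [hzero f hf, zero_mul])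
      (fun h => absurd (Finset.mem_univ e) h)] at h
    exact (mul_neg_of_pos_of_neg he (hp e.1 e.2)).ne h
  obtain ⟨f, hfe, hf⟩ := hex'
  exact Fintype.one_lt_card_iff.2 ⟨⟨e, he⟩, ⟨f, hf⟩, fun h => hfe (congrArg Subtype.val h).symm⟩

/-- At most one facet normal of a Coxeter polytope with `n + 2` facets does not take part in the
linear relation. -/
theorem card_zero_le_one (hM : IsFacetSystem M Q) (hP : P = Q ∩ hypSpace n) (hn : 3 ≤ n)
    (hcox : IsCoxeterPolytope P) (hcard : M.card = n + 2) {c : M → ℝ}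
    (hc : ∀ y : M → ℝ, ∑ e, c e * y e = 0 ↔ ∃ v, ∀ e : M, lorentz e.1 v = y e) :
    Fintype.card {e : M // c e = 0} ≤ 1 := by
  classical
  -- A singleton with zero coefficient is balanced, hence the support of a point lying on all facets
  -- but one. Two such points would share `n` facets, one more than `card_add_one_le` allows.
  have hpt : ∀ e : M, c e = 0 → ∃ a ∈ Q, lorentz e.1 (a, 1) < 0 ∧
      ∀ f ∈ M, f ≠ e.1 → lorentz f (a, 1) = 0 := by
    intro e he
    have hbal : SignBalanced (fun e => SignType.sign (c e)) ({e} : Set M) := by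
      simp [SignBalanced, he]
    rcases (hM.isFaceSupport_iff (by omega) hc {e}).2 hbal with h | ⟨a, ha, h⟩
    · exact absurd h (Set.singleton_ne_empty e)
    · refine ⟨a, ha, ?_, fun f hf hfe => ?_⟩
      · have := (h e).1 rfl
        rw [coord_apply_add] at this
        linarith
      · have := (h ⟨f, hf⟩).not.1 fun heq => hfe (congrArg Subtype.val heq)
        rw [coord_apply_add] at this
        linarith [(hM.mem_iff a).1 ha f hf]
  by_contra! hlt
  obtain ⟨⟨e, he⟩, ⟨f, hf⟩, hef⟩ := Fintype.one_lt_card_iff.1 hlt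
  obtain ⟨a, ha, hae, ha'⟩ := hpt e he
  obtain ⟨b, hb, hbf, hb'⟩ := hpt f hf
  have hef' : e.1 ≠ f.1 := fun h => hef (Subtype.ext (Subtype.ext h))
  have hab : a ≠ b := fun h => (h ▸ hae).ne (hb' e.1 e.2 hef')
  have h := hM.card_add_one_le hP hn hcox ha hb hab (T := (M.erase e.1).erase f.1)
    ((Finset.erase_subset _ _).trans (Finset.erase_subset _ _))
    (fun g hg => ha' g (Finset.mem_of_mem_erase (Finset.mem_of_mem_erase hg))
      (Finset.ne_of_mem_erase (Finset.mem_of_mem_erase hg)))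
    (fun g hg => hb' g (Finset.mem_of_mem_erase (Finset.mem_of_mem_erase hg))
      (Finset.ne_of_mem_erase hg))
  rw [Finset.card_erase_of_mem (Finset.mem_erase.2 ⟨hef'.symm, f.2⟩),
    Finset.card_erase_of_mem e.2] at h
  omega

/-- The numbers of positive, negative and zero coefficients match those of one of the two models,
and they determine the face lattice. -/
theorem combEquiv_of_card_eq (hM : IsFacetSystem M Q) (hP : P = Q ∩ hypSpace n) (hn : 2 ≤ n)
    (hcox : IsCoxeterPolytope P) (hcard : M.card = n + 2) :
    (∃ k l : ℕ, 1 ≤ k ∧ 1 ≤ l ∧ k + l = n ∧ CombEquiv Q (simplexProduct k l)) ∨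
      ∃ k l : ℕ, 1 ≤ k ∧ 1 ≤ l ∧ k + l + 1 = n ∧ CombEquiv Q (pyramidOver (simplexProduct k l)) := by
  classical
  obtain ⟨c, hc0, hc⟩ := hM.exists_relation (by omega) hcard
  have hrel : ∀ v, ∑ e : M, c e * lorentz e.1 v = 0 := fun v => (hc _).2 ⟨v, fun e => rfl⟩
  have h1 : Fintype.card {e : M // 0 < c e} = Fintype.card {e : M // SignType.sign (c e) = 1} :=
    Fintype.card_congr (Equiv.subtypeEquivRight fun e => sign_eq_one_iff.symm)
  have h2 : Fintype.card {e : M // 0 < -c e} = Fintype.card {e : M // SignType.sign (c e) = -1} :=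
    Fintype.card_congr (Equiv.subtypeEquivRight fun e =>
      neg_pos.trans sign_eq_neg_one_iff.symm)
  have h3 : Fintype.card {e : M // c e = 0} = Fintype.card {e : M // SignType.sign (c e) = 0} :=
    Fintype.card_congr (Equiv.subtypeEquivRight fun e => sign_eq_zero_iff.symm)
  have hpos := hM.exists_two_pos hc0 hrel
  have hneg := hM.exists_two_pos (c := fun e => -c e)
    (hc0.imp fun e he => neg_ne_zero.2 he) (fun v => by
      simp only [neg_mul, Finset.sum_neg_distrib, hrel v, neg_zero])
  have hzero : Fintype.card {e : M // c e = 0} ≠ 0 → 3 ≤ n → Fintype.card {e : M // c e = 0} = 1 := by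
    intro h0 hn3
    have := hM.card_zero_le_one hP hn3 hcox hcard hc
    omega
  have hsum : Fintype.card {e : M // SignType.sign (c e) = 1} +
      Fintype.card {e : M // SignType.sign (c e) = -1} +
      Fintype.card {e : M // SignType.sign (c e) = 0} = n + 2 := by
    have h := Fintype.card_congr (Equiv.sigmaFiberEquiv fun e : M => SignType.sign (c e))
    rw [Fintype.card_sigma, Fintype.card_coe, hcard] at h
    have huniv : (Finset.univ : Finset SignType) = {1, -1, 0} := by decide
    rw [huniv, Finset.sum_insert (by decide), Finset.sum_insert (by decide),
      Finset.sum_singleton] at h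
    omega
  rw [h1] at hpos
  rw [h2] at hneg
  rw [h3] at hzero
  obtain ⟨k, hk⟩ := Nat.exists_eq_add_of_le hpos
  obtain ⟨l, hl⟩ := Nat.exists_eq_add_of_le hneg
  by_cases hz : Fintype.card {e : M // SignType.sign (c e) = 0} = 0
  · refine Or.inl ⟨k + 1, l + 1, by omega, by omega, by omega, ?_⟩
    refine combEquiv_of_signBalanced (hM.isFaceCoord (by omega))
      (isFaceCoord_simplexProduct (k + 1) (l + 1)) (hM.isFaceSupport_iff (by omega) hc)
      (isFaceSupport_simplexProduct_iff (k + 1) (l + 1)) fun a => ?_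
    rw [card_simplexProductSign_fiber]
    cases a
    · simpa using hz
    · exact hl.trans (by simp; omega)
    · exact hk.trans (by simp; omega)
  -- Two positive, two negative and one zero coefficient already force `n + 2 ≥ 5`, so the bound for
  -- `n ≥ 3` applies.
  · have hz' := hzero hz (by omega)
    refine Or.inr ⟨k + 1, l + 1, by omega, by omega, by omega, ?_⟩
    refine combEquiv_of_signBalanced (hM.isFaceCoord (by omega))
      (isFaceCoord_pyramidOver (k + 1) (l + 1)) (hM.isFaceSupport_iff (by omega) hc)
      (isFaceSupport_pyramidOver_iff (k + 1) (l + 1)) fun a => ?_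
    rw [card_pyramidSign_fiber]
    cases a
    · simpa using hz'
    · exact hl.trans (by simp; omega)
    · exact hk.trans (by simp; omega)

end IsFacetSystem

/-! ### Pyramids and polytopes with few facets. -/

section Pyramid

variable {V : Type*} [AddCommGroup V] [Module ℝ V]

theorem exists_linearMap_of_notMem_affineSpan {B : Set V} (hB : B.Nonempty) {a : V}
    (ha : a ∉ affineSpan ℝ B) :
    ∃ (φ : V →ₗ[ℝ] ℝ) (d : ℝ), (∀ x ∈ B, φ x = d) ∧ φ a = d + 1 := by
  obtain ⟨b, hb⟩ := hB
  have hmem : a - b ∉ vectorSpan ℝ B := by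
    rw [← direction_affineSpan, ← vsub_eq_sub,
      AffineSubspace.vsub_right_mem_direction_iff_mem (mem_affineSpan ℝ hb)]
    exact ha
  obtain ⟨f, hf, hker⟩ := Submodule.exists_le_ker_of_notMem hmem
  refine ⟨(f (a - b))⁻¹ • f, (f (a - b))⁻¹ * f b, fun x hx => ?_, ?_⟩
  · have h : f (x - b) = 0 := hker (vsub_mem_vectorSpan ℝ hx hb)
    rw [map_sub, sub_eq_zero] at h
    rw [LinearMap.smul_apply, smul_eq_mul, h]
  · have h : f a = f b + f (a - b) := by rw [map_sub]; ring
    rw [LinearMap.smul_apply, smul_eq_mul]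
    conv_lhs => rw [h]
    rw [mul_add, inv_mul_cancel₀ hf]

theorem exists_eq_add_smul_of_mem_convexHull_insert {D : Set V} (hD : D.Nonempty) {a y : V}
    (hy : y ∈ convexHull ℝ (insert a D)) :
    ∃ b ∈ convexHull ℝ D, ∃ t : ℝ, 0 ≤ t ∧ t ≤ 1 ∧ y = (1 - t) • a + t • b := by
  rw [convexHull_insert hD, mem_convexJoin] at hy
  obtain ⟨_, rfl, b, hb, s, t, hs, ht, hst, rfl⟩ := hy
  exact ⟨b, hb, t, ht, by linarith, by rw [← hst, add_sub_cancel_right]⟩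

theorem eq_of_mem_convexHull {D : Set V} {φ : V →ₗ[ℝ] ℝ} {d : ℝ} (h : ∀ x ∈ D, φ x = d) {b : V}
    (hb : b ∈ convexHull ℝ D) : φ b = d :=
  convexHull_min (t := {x | φ x = d}) h (convex_hyperplane φ.isLinear d) hb

/-- The base of a pyramid is one of its faces. -/
theorem isExtreme_convexHull_insert {B : Set V} (hB : B.Nonempty) (hBc : Convex ℝ B) {a : V}
    {φ : V →ₗ[ℝ] ℝ} {d : ℝ} (h : ∀ x ∈ B, φ x = d) (ha : φ a = d + 1) :
    IsExtreme ℝ (convexHull ℝ (insert a B)) B where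
  subset := (Set.subset_insert a B).trans (subset_convexHull ℝ _)
  left_mem_of_mem_openSegment := by
    intro x hx y hy z hz hzxy
    have key : ∀ w ∈ convexHull ℝ (insert a B), d ≤ φ w ∧ (φ w = d → w ∈ B) := by
      intro w hw
      obtain ⟨b, hb, t, ht0, ht1, rfl⟩ := exists_eq_add_smul_of_mem_convexHull_insert hB hw
      rw [hBc.convexHull_eq] at hb
      have hval : φ ((1 - t) • a + t • b) = d + (1 - t) := by
        rw [map_add, map_smul, map_smul, h b hb, ha, smul_eq_mul, smul_eq_mul]
        ring
      rw [hval]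
      refine ⟨by linarith, fun heq => ?_⟩
      have ht : t = 1 := by linarith
      rw [ht, sub_self, zero_smul, one_smul, zero_add]
      exact hb
    obtain ⟨α, β, hα, hβ, hαβ, rfl⟩ := hzxy
    have hzd := h _ hz
    rw [map_add, map_smul, map_smul, smul_eq_mul, smul_eq_mul] at hzd
    have hx' := key x hx
    have hy' := key y hy
    refine hx'.2 (le_antisymm ?_ hx'.1)
    have h1 : α * (φ x - d) + β * (φ y - d) = 0 := by linear_combination hzd - d * hαβ
    have h2 : 0 ≤ β * (φ y - d) := mul_nonneg hβ.le (by linarith [hy'.1])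
    by_contra hlt
    have h3 : 0 < α * (φ x - d) := mul_pos hα (by linarith [not_le.1 hlt])
    linarith

theorem isSimplex_of_subsingleton {B : Set V} (hB : B.Subsingleton) : IsSimplex B := by
  rcases hB.eq_empty_or_singleton with rfl | ⟨x, rfl⟩
  · refine ⟨∅, ?_, by simp⟩
    exact affineIndependent_of_subsingleton ℝ _
  · refine ⟨{x}, ?_, by simp⟩
    exact affineIndependent_of_subsingleton ℝ _

end Pyramid

namespace IsFacetSystem

variable {n : ℕ} {M : Finset (EuclideanSpace ℝ (Fin n) × ℝ)} {Q P : Set (EuclideanSpace ℝ (Fin n))}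

/-- At most one facet of a pyramid misses the apex. -/
theorem eq_of_lorentz_apex_ne_zero (hM : IsFacetSystem M Q) {D : Set (EuclideanSpace ℝ (Fin n))}
    (hD : D.Nonempty) {a : EuclideanSpace ℝ (Fin n)} (hQ : Q = convexHull ℝ (insert a D))
    {φ : EuclideanSpace ℝ (Fin n) →ₗ[ℝ] ℝ} {d : ℝ} (hφ : ∀ x ∈ D, φ x = d) (ha : φ a ≠ d)
    {e f : EuclideanSpace ℝ (Fin n) × ℝ} (he : e ∈ M) (hf : f ∈ M)
    (hea : lorentz e (a, 1) ≠ 0) (hfa : lorentz f (a, 1) ≠ 0) : e = f := by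
  by_contra hne
  have haQ : a ∈ Q := hQ ▸ subset_convexHull ℝ _ (Set.mem_insert a D)
  have hDQ : convexHull ℝ D ⊆ Q := hQ ▸ convexHull_mono (Set.subset_insert a D)
  -- A point of a facet missing the apex has apex weight zero, so the facet lies in the base
  -- hyperplane.
  have hfacet : ∀ g ∈ M, lorentz g (a, 1) ≠ 0 → ∀ y ∈ Q, lorentz g (y, 1) = 0 → φ y = d := by
    intro g hg hga y hy hgy
    have hga' := lt_of_le_of_ne ((hM.mem_iff a).1 haQ g hg) hga
    rw [hQ] at hy
    obtain ⟨b, hb, t, ht0, ht1, rfl⟩ := exists_eq_add_smul_of_mem_convexHull_insert hD hy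
    have hgb := (hM.mem_iff b).1 (hDQ hb) g hg
    have heq : lorentz g ((1 - t) • a + t • b, 1) =
        (1 - t) * lorentz g (a, 1) + t * lorentz g (b, 1) := by
      simp only [lorentz_mk_one, inner_add_right, real_inner_smul_right]
      ring
    rw [heq] at hgy
    have ht : t = 1 := by
      by_contra ht
      have h1 : 0 < 1 - t := by
        have := lt_of_le_of_ne ht1 ht
        linarith
      nlinarith [mul_neg_of_pos_of_neg h1 hga', mul_nonpos_of_nonneg_of_nonpos ht0 hgb]
    rw [ht, sub_self, zero_smul, one_smul, zero_add]
    exact eq_of_mem_convexHull hφ hb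
  obtain ⟨z, hz, hz'⟩ := hM.exists_facet_point e he
  obtain ⟨w, hw, hw'⟩ := hM.exists_facet_point f hf
  have hmem : ∀ g ∈ M, ∀ x, lorentz g (x, 1) = 0 → (∀ k ∈ M, k ≠ g → lorentz k (x, 1) < 0) →
      x ∈ Q := by
    intro g _ x hx hx'
    refine (hM.mem_iff x).2 fun k hk => ?_
    by_cases hkg : k = g
    · exact hkg ▸ hx.le
    · exact (hx' k hk hkg).le
  have hφz := hfacet e he hea z (hmem e he z hz hz') hz
  have hφw := hfacet f hf hfa w (hmem f hf w hw hw') hw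
  have hdir : ∀ u, lorentz e (u, 0) = 0 → φ u = 0 := by
    intro u hu
    obtain ⟨ε, hε, h⟩ := exists_pos_add_smul_nonpos M (fun k => lorentzForm n k) (z, 1) (u, 0)
      fun k hk => by
        by_cases hke : k = e
        · exact Or.inr (hke ▸ ⟨hz, hu⟩)
        · exact Or.inl (hz' k hk hke)
    rw [← mk_add_smul_one] at h
    have h1 := hfacet e he hea (z + ε • u) ((hM.mem_iff _).2 h) (by
      rw [mk_add_smul_one, lorentz_add_right, lorentz_smul_right, hz, hu, mul_zero, add_zero])
    rw [map_add, map_smul, hφz, smul_eq_mul, add_eq_left] at h1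
    exact (mul_eq_zero.1 h1).resolve_left hε.ne'
  have hew : lorentz e (w, 1) < 0 := hw' e he hne
  -- Correcting `a - z` by a multiple of `w - z` makes it parallel to the facet of `e`. Since `φ`
  -- agrees at `z` and `w`, it would then take the value `d` at the apex.
  have h1 := hdir (a - z - (lorentz e (a, 1) / lorentz e (w, 1)) • (w - z)) (by
    rw [lorentz_mk_one] at hz
    rw [lorentz_mk_zero, inner_sub_right, inner_sub_right, real_inner_smul_right, inner_sub_right]
    have h2 : inner ℝ e.1 z = e.2 := by linarith
    rw [h2, ← lorentz_mk_one, ← lorentz_mk_one, div_mul_cancel₀ _ hew.ne, sub_self])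
  rw [map_sub, map_sub, map_smul, map_sub, hφz, hφw, sub_self, smul_zero, sub_zero] at h1
  exact ha (sub_eq_zero.1 h1)

/-- In a polytope with at most `n + 1` facets every extreme point misses exactly one facet, and is
determined by it. -/
theorem exists_missed_facet (hM : IsFacetSystem M Q) (hn : 1 ≤ n) (hcard : M.card ≤ n + 1)
    {x : EuclideanSpace ℝ (Fin n)} (hx : x ∈ Q.extremePoints ℝ) :
    ∃ e ∈ M, lorentz e (x, 1) ≠ 0 ∧ (∀ f ∈ M, f ≠ e → lorentz f (x, 1) = 0) ∧
      ∀ y, (∀ f ∈ M, f ≠ e → lorentz f (y, 1) = 0) → y = x := by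
  classical
  obtain ⟨e, he, hex⟩ := hM.exists_lorentz_ne_zero hn x
  have hle := (hM.mem_iff x).1 hx.1
  -- An extreme point cannot move both ways along a direction parallel to all facets through it.
  -- Hence the normals of these facets span, and there are at least `n` of them.
  have hdir : ∀ u : EuclideanSpace ℝ (Fin n),
      (∀ f ∈ M, lorentz f (x, 1) = 0 → inner ℝ f.1 u = 0) → u = 0 := by
    intro u hu
    have hmove : ∀ w : EuclideanSpace ℝ (Fin n),
        (∀ f ∈ M, lorentz f (x, 1) = 0 → inner ℝ f.1 w = 0) → ∃ ε : ℝ, 0 < ε ∧ x + ε • w ∈ Q := by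
      intro w hw
      obtain ⟨ε, hε, h⟩ := exists_pos_add_smul_nonpos M (fun k => lorentzForm n k) (x, 1) (w, 0)
        fun k hk => by
          rcases (hle k hk).lt_or_eq with h | h
          · exact Or.inl h
          · exact Or.inr ⟨h, by rw [lorentzForm_apply, lorentz_mk_zero]; exact hw k hk h⟩
      rw [← mk_add_smul_one] at h
      exact ⟨ε, hε, (hM.mem_iff _).2 h⟩
    obtain ⟨ε, hε, h1⟩ := hmove u hu
    obtain ⟨δ, hδ, h2⟩ := hmove (-u) fun f hf hfx => by rw [inner_neg_right, hu f hf hfx, neg_zero]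
    have hseg : x ∈ openSegment ℝ (x + ε • u) (x + δ • -u) := by
      refine ⟨δ / (ε + δ), ε / (ε + δ), by positivity, by positivity, by field_simp; ring, ?_⟩
      have h3 : δ / (ε + δ) + ε / (ε + δ) = 1 := by field_simp; ring
      calc _ = (δ / (ε + δ) + ε / (ε + δ)) • x := by module
        _ = x := by rw [h3, one_smul]
    have h3 := hx.2 h1 h2 hseg
    rw [add_eq_left] at h3
    exact (smul_eq_zero.1 h3).resolve_left hε.ne'
  set T := M.filter (fun f => lorentz f (x, 1) = 0) with hT
  have hspan : n ≤ T.card := by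
    have hbot : (Submodule.span ℝ ((T.image Prod.fst : Finset _) :
        Set (EuclideanSpace ℝ (Fin n))))ᗮ = ⊥ := by
      rw [Submodule.eq_bot_iff]
      intro u hu
      rw [mem_span_orthogonal_iff] at hu
      exact hdir u fun f hf hfx => hu f.1
        (Finset.mem_coe.2 (Finset.mem_image_of_mem _ (Finset.mem_filter.2 ⟨hf, hfx⟩)))
    have h1 := Submodule.finrank_add_finrank_orthogonal (Submodule.span ℝ
      ((T.image Prod.fst : Finset _) : Set (EuclideanSpace ℝ (Fin n))))
    rw [hbot, finrank_bot, finrank_euclideanSpace_fin, add_zero] at h1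
    calc n = _ := h1.symm
      _ ≤ (T.image Prod.fst).card := finrank_span_finset_le_card _
      _ ≤ T.card := Finset.card_image_le
  have hTsub : T ⊆ M.erase e := fun f hf => by
    obtain ⟨hfM, hfx⟩ := Finset.mem_filter.1 hf
    exact Finset.mem_erase.2 ⟨fun h => hex (h ▸ hfx), hfM⟩
  have hTeq : T = M.erase e := Finset.eq_of_subset_of_card_le hTsub (by
    rw [Finset.card_erase_of_mem he]
    omega)
  have hTe : ∀ f ∈ M, lorentz f (x, 1) = 0 → f ≠ e := fun f _ hfx h => hex (h ▸ hfx)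
  refine ⟨e, he, hex, fun f hf hfe => ?_, fun y hy => ?_⟩
  · have : f ∈ T := hTeq ▸ Finset.mem_erase.2 ⟨hfe, hf⟩
    exact (Finset.mem_filter.1 this).2
  · refine sub_eq_zero.1 (hdir (y - x) fun f hf hfx => ?_)
    have h1 := hy f hf (hTe f hf hfx)
    rw [lorentz_mk_one] at h1 hfx
    rw [inner_sub_right]
    linarith

/-- A polytope with at most `n + 1` facets has affinely independent extreme points. -/
theorem affineIndependent_of_subset_extremePoints (hM : IsFacetSystem M Q) (hn : 1 ≤ n)
    (hcard : M.card ≤ n + 1) {s : Finset (EuclideanSpace ℝ (Fin n))}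
    (hs : ∀ x ∈ s, x ∈ Q.extremePoints ℝ) :
    AffineIndependent ℝ (fun v : s => (v : EuclideanSpace ℝ (Fin n))) := by
  rw [affineIndependent_iff]
  intro t w hw hsum i hi
  obtain ⟨e, he, hei, -, huniq⟩ := hM.exists_missed_facet hn hcard (hs i.1 i.2)
  -- Distinct extreme points miss distinct facets, so `e` isolates the coefficient of the point `i`
  -- in an affine relation lifted to height `1`.
  have hzero : ∀ j : s, j ≠ i → lorentz e (j.1, 1) = 0 := by
    intro j hj
    obtain ⟨f, hf, -, hf', -⟩ := hM.exists_missed_facet hn hcard (hs j.1 j.2)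
    by_contra hne
    have hfe : f = e := by
      by_contra hfe
      exact hne (hf' e he (Ne.symm hfe))
    rw [hfe] at hf'
    exact hj (Subtype.ext (huniq j.1 hf'))
  have h1 : ∑ j ∈ t, w j • ((j.1, (1 : ℝ)) : EuclideanSpace ℝ (Fin n) × ℝ) = 0 := by
    refine Prod.ext ?_ ?_
    · rw [Prod.fst_sum]
      exact hsum
    · rw [Prod.snd_sum]
      simpa using hw
  have h2 := congrArg (lorentzForm n e) h1
  rw [map_sum, map_zero, Finset.sum_eq_single i
    (fun j _ hj => by rw [map_smul, lorentzForm_apply, hzero j hj, smul_zero])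
    (fun h => absurd hi h), map_smul, lorentzForm_apply, smul_eq_mul] at h2
  exact (mul_eq_zero.1 h2).resolve_right hei

/-- Both apexes `a` and `b` can serve as apex of `Q`, so all but two facets contain both, leaving at
most `n + 1` facets. The extreme points of `C` are extreme in `Q`, hence affinely independent,
contradicting that `C` is not a simplex. -/
theorem not_isMultipyramid (hM : IsFacetSystem M Q) (hP : P = Q ∩ hypSpace n)
    (hcox : IsCoxeterPolytope P) : ¬ IsMultipyramid Q := by
  classical
  rintro ⟨B, C, ⟨-, -, a, ha, hQ⟩, ⟨s, hC⟩, hCs, b, hb, hB⟩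
  have hnt : C.Nontrivial := by
    rw [← Set.not_subsingleton_iff]
    exact fun h => hCs (isSimplex_of_subsingleton h)
  have hCc : Convex ℝ C := hC ▸ convex_convexHull ℝ _
  have hBc : Convex ℝ B := hB ▸ convex_convexHull ℝ _
  have hCB : C ⊆ B := hB ▸ (Set.subset_insert b C).trans (subset_convexHull ℝ _)
  have hbB : b ∈ B := hB ▸ subset_convexHull ℝ _ (Set.mem_insert b C)
  obtain ⟨φ, d, hφ, hφa⟩ := exists_linearMap_of_notMem_affineSpan ⟨b, hbB⟩ ha
  obtain ⟨ψ, r, hψ, hψb⟩ := exists_linearMap_of_notMem_affineSpan hnt.nonempty hb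
  obtain ⟨x, hx, y, hy, hxy⟩ := hnt
  have hne : (insert b C).Nonempty := ⟨b, Set.mem_insert b C⟩
  have hQa : Q = convexHull ℝ (insert a (insert b C)) := by
    rw [hQ, hB, Set.insert_eq, convexHull_convexHull_union_right, ← Set.insert_eq]
  have hQb : Q = convexHull ℝ (insert b (insert a C)) := by
    rw [hQa, Set.insert_comm]
  -- Since `C` is not a simplex it has two points, which together with the two apexes are affinely
  -- independent.
  have hn : 3 ≤ n := by
    have hli : LinearIndependent ℝ ![a - x, b - x, y - x] := by
      rw [Fintype.linearIndependent_iff]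
      intro g hg
      simp only [Fin.sum_univ_three, Matrix.cons_val_zero, Matrix.cons_val_one,
        Matrix.cons_val_two, Matrix.head_cons, Matrix.tail_cons] at hg
      have h0 : g 0 = 0 := by
        have h := congrArg φ hg
        simpa only [map_add, map_smul, map_sub, hφa, hφ b hbB, hφ x (hCB hx), hφ y (hCB hy),
          smul_eq_mul, sub_self, mul_zero, add_zero, map_zero, add_sub_cancel_left, mul_one] using h
      have h1 : g 1 = 0 := by
        have h := congrArg ψ hg
        rw [h0, zero_smul, zero_add] at h
        simpa only [map_add, map_smul, map_sub, hψb, hψ x hx, hψ y hy,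
          smul_eq_mul, sub_self, mul_zero, add_zero, map_zero, add_sub_cancel_left, mul_one] using h
      have h2 : g 2 = 0 := by
        rw [h0, h1, zero_smul, zero_smul, zero_add, zero_add] at hg
        exact (smul_eq_zero.1 hg).resolve_right (sub_ne_zero.2 hxy.symm)
      intro i
      fin_cases i
      · exact h0
      · exact h1
      · exact h2
    have := hli.fintype_card_le_finrank
    rwa [Fintype.card_fin, finrank_euclideanSpace_fin] at this
  have haQ : a ∈ Q := hQ ▸ subset_convexHull ℝ _ (Set.mem_insert a B)
  have hbQ : b ∈ Q := hQb ▸ subset_convexHull ℝ _ (Set.mem_insert b _)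
  have hab : a ≠ b := fun h => by
    rw [h, hφ b hbB] at hφa
    linarith
  have ha1 : (M.filter fun e => lorentz e (a, 1) ≠ 0).card ≤ 1 := by
    refine Finset.card_le_one.2 fun e he f hf => ?_
    rw [Finset.mem_filter] at he hf
    exact hM.eq_of_lorentz_apex_ne_zero hne hQa (φ := φ) (d := d)
      (fun w hw => hφ w (hB ▸ subset_convexHull ℝ _ hw)) (by rw [hφa]; simp)
      he.1 hf.1 he.2 hf.2
  have hb1 : (M.filter fun e => lorentz e (b, 1) ≠ 0).card ≤ 1 := by
    refine Finset.card_le_one.2 fun e he f hf => ?_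
    rw [Finset.mem_filter] at he hf
    refine hM.eq_of_lorentz_apex_ne_zero (Set.insert_nonempty a C) hQb
      -- The multiple of `φ` is chosen so that the functional takes the same value at `a` as on `C`;
      -- at `b` it is larger by `1`.
      (φ := ψ - (ψ a - r) • φ) (d := r - (ψ a - r) * d) ?_ ?_ he.1 hf.1 he.2 hf.2
    · rintro w (rfl | hw)
      · rw [LinearMap.sub_apply, LinearMap.smul_apply, hφa, smul_eq_mul]
        ring
      · rw [LinearMap.sub_apply, LinearMap.smul_apply, hφ w (hCB hw), hψ w hw, smul_eq_mul]
    · rw [LinearMap.sub_apply, LinearMap.smul_apply, hφ b hbB, hψb, smul_eq_mul]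
      intro h
      linarith
  have hcard : M.card ≤ n + 1 := by
    set T := M.filter fun e => lorentz e (a, 1) = 0 ∧ lorentz e (b, 1) = 0 with hT
    have h1 := hM.card_add_one_le hP hn hcox haQ hbQ hab (T := T) (Finset.filter_subset _ _)
      (fun e he => (Finset.mem_filter.1 he).2.1) (fun e he => (Finset.mem_filter.1 he).2.2)
    have h2 : M ⊆ (T ∪ M.filter fun e => lorentz e (a, 1) ≠ 0) ∪
        M.filter fun e => lorentz e (b, 1) ≠ 0 := by
      intro e he
      simp only [hT, Finset.mem_union, Finset.mem_filter]
      tauto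
    have h3 := Finset.card_le_card h2
    have h4 := Finset.card_union_le (T ∪ M.filter fun e => lorentz e (a, 1) ≠ 0)
      (M.filter fun e => lorentz e (b, 1) ≠ 0)
    have h5 := Finset.card_union_le T (M.filter fun e => lorentz e (a, 1) ≠ 0)
    omega
  have hextB : IsExtreme ℝ Q B :=
    hQ ▸ isExtreme_convexHull_insert ⟨b, hbB⟩ hBc hφ hφa
  have hextC : IsExtreme ℝ B C :=
    hB ▸ isExtreme_convexHull_insert ⟨x, hx⟩ hCc hψ hψb
  have hfin : (C.extremePoints ℝ).Finite := by
    refine s.finite_toSet.subset ?_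
    rw [hC]
    exact extremePoints_convexHull_subset
  refine hCs ⟨hfin.toFinset, hM.affineIndependent_of_subset_extremePoints (by omega) hcard
    fun v hv => hextB.extremePoints_subset_extremePoints
      (hextC.extremePoints_subset_extremePoints (hfin.mem_toFinset.1 hv)), ?_⟩
  rw [hfin.coe_toFinset]
  -- Krein–Milman: `C` is the hull of its extreme points, which is already closed because they are
  -- finitely many.
  have hcomp : IsCompact C := hC ▸ s.finite_toSet.isCompact_convexHull ℝ
  rw [← (hfin.isClosed_convexHull ℝ).closure_eq]
  exact (closure_convexHull_extremePoints hcomp hCc).symm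

end IsFacetSystem

/-! ### Low dimensions and conclusion. -/

/-- On a line every facet is the maximum or the minimum of `P`. This rules out `n + 2` facets for `n
= 1`, where facets and normals need not correspond. -/
theorem ncard_facets_one_le (P : Set (EuclideanSpace ℝ (Fin 1))) : (facets P).ncard ≤ 2 := by
  have hinner : ∀ u v : EuclideanSpace ℝ (Fin 1), inner ℝ u v = u 0 * v 0 := by
    intro u v
    simp [PiLp.inner_apply, mul_comm]
  have hext : ∀ u v : EuclideanSpace ℝ (Fin 1), u 0 = v 0 → u = v := by
    intro u v h
    ext i
    rw [Subsingleton.elim i 0, h]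
  have hsub : facets P ⊆ {{x | x ∈ P ∧ ∀ y ∈ P, y 0 ≤ x 0}, {x | x ∈ P ∧ ∀ y ∈ P, x 0 ≤ y 0}} := by
    rintro _ ⟨e, ⟨he1, he2, ⟨z, hz⟩, -⟩, rfl⟩
    have he0 : e.1 0 ≠ 0 := by
      intro h
      refine fst_ne_zero_of_lorentz_pos (e := e) (by rw [he1]; exact one_pos) (hext _ _ ?_)
      rw [h]
      rfl
    have hz' : e.1 0 * z 0 = e.2 := hinner _ _ ▸ hz.2.2
    have hle : ∀ y ∈ P, e.1 0 * y 0 ≤ e.1 0 * z 0 := fun y hy => by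
      rw [hz', ← hinner]
      exact (he2 hy).2
    have huniq : P ∩ hypHyperplane e = {z} := by
      refine Set.eq_singleton_iff_unique_mem.2 ⟨hz, fun x hx => hext _ _ ?_⟩
      have hx' : e.1 0 * x 0 = e.2 := hinner _ _ ▸ hx.2.2
      exact mul_left_cancel₀ he0 (hx'.trans hz'.symm)
    show P ∩ hypHyperplane e = _ ∨ P ∩ hypHyperplane e = _
    rw [huniq]
    rcases lt_or_gt_of_ne he0 with h | h
    · refine Or.inr ?_
      have hmin : ∀ y ∈ P, z 0 ≤ y 0 := fun y hy => (mul_le_mul_left_of_neg h).1 (hle y hy)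
      have hmem : z ∈ {x | x ∈ P ∧ ∀ y ∈ P, x 0 ≤ y 0} := ⟨hz.1, hmin⟩
      refine (Set.Subset.antisymm (fun x hx => hext _ _ ?_)
        (Set.singleton_subset_iff.2 hmem)).symm
      exact le_antisymm (hx.2 z hz.1) (hmin x hx.1)
    · refine Or.inl ?_
      have hmax : ∀ y ∈ P, y 0 ≤ z 0 := fun y hy => le_of_mul_le_mul_left (hle y hy) h
      have hmem : z ∈ {x | x ∈ P ∧ ∀ y ∈ P, y 0 ≤ x 0} := ⟨hz.1, hmax⟩
      refine (Set.Subset.antisymm (fun x hx => hext _ _ ?_)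
        (Set.singleton_subset_iff.2 hmem)).symm
      exact le_antisymm (hmax x hx.1) (hx.2 z hz.1)
  exact (Set.ncard_le_ncard hsub (Set.toFinite _)).trans ((Set.ncard_insert_le _ _).trans
    (by rw [Set.ncard_singleton]))

theorem two_le_of_ncard_facets {n : ℕ} {P : Set (EuclideanSpace ℝ (Fin n))}
    (h : (facets P).ncard = n + 2) : 2 ≤ n := by
  match n, P, h with
  | 0, P, h =>
    have : facets P = ∅ := by
      rw [facets, Set.image_eq_empty]
      exact Set.eq_empty_of_forall_notMem fun e he => Nat.succ_ne_zero _ he.2.2.2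
    rw [this, Set.ncard_empty] at h
    omega
  | 1, P, h =>
    have := ncard_facets_one_le P
    omega
  | n + 2, _, _ => omega

theorem lemma1 (n : ℕ) (P : Set (EuclideanSpace ℝ (Fin n))) (hP : IsCoxeterPolytope P) :
    ((facets P).ncard = n + 2 →
      (∃ k l : ℕ, 1 ≤ k ∧ 1 ≤ l ∧ k + l = n ∧ CombEquiv (completed P) (simplexProduct k l)) ∨
      (∃ k l : ℕ, 1 ≤ k ∧ 1 ≤ l ∧ k + l + 1 = n ∧
        CombEquiv (completed P) (pyramidOver (simplexProduct k l)))) ∧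
    ¬ IsMultipyramid (completed P) := by
  obtain ⟨M, hM, hPQ⟩ := hP.toIsHypPolytope.exists_isFacetSystem
  refine ⟨fun hfacets => ?_, hM.not_isMultipyramid hPQ hP⟩
  have hn := two_le_of_ncard_facets hfacets
  exact hM.combEquiv_of_card_eq hPQ hn hP
    ((hM.ncard_facets hPQ hn Set.Subset.rfl).symm.trans hfacets)
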